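/- Consider two parties, each with two settings ($x,y\in\{0,1\}$) and two outcomes ($a,b\in\{0,1\}$), and behaviours $P(a,b|A_x,B_y)$. Let the Hardy zero constraints be $$P(0,1|A_0,B_1)=P(1,0|A_1,B_0)=P(0,0|A_1,B_1)=0,$$ and let $P^w_{Hardy}=P(0,0|A_0,B_0)+w\,P(1,1|A_0,B_0)$ for a real parameter $w$. A quantum strategy consists of finite-dimensional complex Hilbert spaces $H_A,H_B$, a density matrix $\rho$ on $H_A\otimes H_B$ and binary observables $A_x$ on $H_A$, $B_y$ on $H_B$ (Hermitian with $A_x^2=1$, $B_y^2=1$; outcome $0$ is eigenvalue $+1$, outcome $1$ is eigenvalue $-1$), with $P(a,b|A_x,B_y)=\mathrm{Tr}[(A_{a|x}\otimes B_{b|y})\rho]$ for the eigenprojectors $A_{a|x},B_{b|y}$. (1) Every local hidden variable model $P(a,b|A_x,B_y)=\int P(a|x,\lambda)P(b|y,\lambda)\,d\mu(\lambda)$ that satisfies the Hardy zero constraints has $P^w_{Hardy}\le\max(0,w)$, and this bound is attained by such a model. (2) Let $w\in(-\frac14,1)$. Put $$P^{w,Q}_{Hardy}=\frac{(4w+5)\sqrt{4w+5}-(12w+11)}{2(w+1)},\qquad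 \theta=\arcsin(3-\sqrt{4w+5}),\qquad |\psi_\theta\rangle=\cos\tfrac\theta2|00\rangle-\sin\tfrac\theta2|11\rangle,$$ and, with the Pauli matrices $X$ and $Z$, let $$A_0=B_0=-\frac{(2+\sin\theta)\sqrt{1-\sin\theta}}{(2-\sin\theta)\sqrt{1+\sin\theta}}\,Z-\frac{\sqrt2\,\sin\theta\sqrt{\sin\theta}}{(2-\sin\theta)\sqrt{1+\sin\theta}}\,X,\qquad A_1=B_1=-\frac{\sqrt{1-\sin\theta}}{\sqrt{1+\sin\theta}}\,Z+\frac{\sqrt2\sqrt{\sin\theta}}{\sqrt{1+\sin\theta}}\,X .$$ Then $P^{w,Q}_{Hardy}>\max(0,w)$. The state $|\psi_\theta\rangle$ with these observables satisfies the Hardy zero constraints and has $P^w_{Hardy}=P^{w,Q}_{Hardy}$, and every quantum strategy that satisfies the Hardy zero constraints has $P^w_{Hardy}\le P^{w,Q}_{Hardy}$. Moreover, a quantum strategy $(\rho,A'_x,B'_y)$ satisfies the Hardy zero constraints and has $P^w_{Hardy}=P^{w,Q}_{Hardy}$ if and only if it is equal to the above one up to local isometries, that is, there are isometries $V_A:H_A\to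 H_A\otimes\mathbb C^2$ and $V_B:H_B\to H_B\otimes\mathbb C^2$ such that for every vector $|\xi\rangle$ in the range of $\rho$ there is a vector $|\chi\rangle\in H_A\otimes H_B$ with $$(V_A\otimes V_B)(M'\otimes N')|\xi\rangle=|\chi\rangle\otimes (M\otimes N)|\psi_\theta\rangle$$ for all $(M',M)\in\{(1,1),(A'_0,A_0),(A'_1,A_1)\}$ and $(N',N)\in\{(1,1),(B'_0,B_0),(B'_1,B_1)\}$. (3) Consequently every entangled pure two-qubit state $|\varphi\rangle$ that is not maximally entangled (its reduced state is not $\frac12 1$) is self-tested: there are $w\in(-\frac14,1)$ and binary qubit observables $A_x,B_y$ such that $|\varphi\rangle$ with $A_x,B_y$ satisfies the Hardy zero constraints with $P^w_{Hardy}=P^{w,Q}_{Hardy}$, and a quantum strategy satisfies the Hardy zero constraints with $P^w_{Hardy}=P^{w,Q}_{Hardy}$ if and only if it is equal to $(|\varphi\rangle,A_x,B_y)$ up to local isometries in the above sense. -/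

import Mathlib

open scoped ComplexOrder Kronecker Matrix
open MeasureTheory

/-- A behaviour in the Bell scenario with two parties, two settings and two outcomes each:
`P a b x y` stands for the probability `P(a, b | A_x, B_y)`. -/
abbrev Behavior : Type := Fin 2 → Fin 2 → Fin 2 → Fin 2 → ℝ

/-- The Hardy zero constraints
`P(0,1|A_0,B_1) = P(1,0|A_1,B_0) = P(0,0|A_1,B_1) = 0`. -/
def HardyZero (P : Behavior) : Prop :=
  P 0 1 0 1 = 0 ∧ P 1 0 1 0 = 0 ∧ P 0 0 1 1 = 0

/-- The tilted Hardy expression `P(0,0|A_0,B_0) + w * P(1,1|A_0,B_0)`. -/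
def hardyValue (w : ℝ) (P : Behavior) : ℝ :=
  P 0 0 0 0 + w * P 1 1 0 0

/-- A local hidden variable model: a hidden variable `l` with distribution `μ` (which does not
depend on the settings) and local response functions `pA a x l = P(a | x, l)`,
`pB b y l = P(b | y, l)`. -/
structure LHVModel (Ω : Type*) [MeasurableSpace Ω] where
  /-- distribution of the hidden variable -/
  μ : Measure Ω
  isProb : IsProbabilityMeasure μ
  /-- response functions of the first party -/
  pA : Fin 2 → Fin 2 → Ω → ℝ
  /-- response functions of the second party -/
  pB : Fin 2 → Fin 2 → Ω → ℝ
  measurable_pA : ∀ a x, Measurable (pA a x)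
  measurable_pB : ∀ b y, Measurable (pB b y)
  pA_nonneg : ∀ a x l, 0 ≤ pA a x l
  pB_nonneg : ∀ b y l, 0 ≤ pB b y l
  pA_sum : ∀ x l, ∑ a, pA a x l = 1
  pB_sum : ∀ y l, ∑ b, pB b y l = 1

/-- `P(a, b | x, y) = ∫ P(a | x, l) P(b | y, l) dμ(l)`. -/
noncomputable def LHVModel.behavior {Ω : Type*} [MeasurableSpace Ω] (m : LHVModel Ω) :
    Behavior :=
  fun a b x y => ∫ l, m.pA a x l * m.pB b y l ∂m.μ

/-- A binary observable with outcomes `±1`: a Hermitian matrix with square the identity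
(`± 1` themselves are allowed). -/
def IsBinaryObservable {ι : Type*} [Fintype ι] [DecidableEq ι] (M : Matrix ι ι ℂ) : Prop :=
  M.IsHermitian ∧ M * M = 1

/-- The projector of a binary observable onto its eigenspace with eigenvalue `(-1) ^ a`;
outcome `0` is eigenvalue `+1`, outcome `1` is eigenvalue `-1`. -/
noncomputable def outcomeProj {ι : Type*} [DecidableEq ι] (M : Matrix ι ι ℂ) (a : Fin 2) :
    Matrix ι ι ℂ :=
  (1 / 2 : ℂ) • (1 + (-1 : ℂ) ^ (a : ℕ) • M)

/-- A bipartite quantum strategy on the Hilbert spaces `ℂ^ιA` and `ℂ^ιB`: a (possibly mixed)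
shared state and two binary observables for each party. -/
structure QuantumStrategy (ιA ιB : Type*) [Fintype ιA] [DecidableEq ιA]
    [Fintype ιB] [DecidableEq ιB] where
  /-- the shared density matrix -/
  ρ : Matrix (ιA × ιB) (ιA × ιB) ℂ
  /-- observables of the first party -/
  A : Fin 2 → Matrix ιA ιA ℂ
  /-- observables of the second party -/
  B : Fin 2 → Matrix ιB ιB ℂ
  posSemidef : ρ.PosSemidef
  trace_eq_one : ρ.trace = 1
  observable_A : ∀ x, IsBinaryObservable (A x)
  observable_B : ∀ y, IsBinaryObservable (B y)

/-- The Born rule `P(a, b | x, y) = Tr[(A_{a|x} ⊗ B_{b|y}) ρ]`. -/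
noncomputable def QuantumStrategy.behavior {ιA ιB : Type*} [Fintype ιA] [DecidableEq ιA]
    [Fintype ιB] [DecidableEq ιB] (s : QuantumStrategy ιA ιB) : Behavior :=
  fun a b x y =>
    (Matrix.trace ((outcomeProj (s.A x) a ⊗ₖ outcomeProj (s.B y) b) * s.ρ)).re

/-- The rank-one matrix `|φ⟩⟨φ|`. -/
def pureState {ι : Type*} (φ : ι → ℂ) : Matrix ι ι ℂ :=
  Matrix.vecMulVec φ (star φ)

/-- A pair of observables, completed by the identity (index `none`). -/
def withId {ι : Type*} [DecidableEq ι] (M : Fin 2 → Matrix ι ι ℂ) :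
    Option (Fin 2) → Matrix ι ι ℂ
  | none => 1
  | some x => M x

/-- The strategy `s` is, up to local isometries, the two-qubit state `φ` with the qubit
observables `A`, `B`: there are isometries `VA : H_A → H_A ⊗ ℂ²` and `VB : H_B → H_B ⊗ ℂ²`
(adjoin a qubit in the state `|0⟩` and act by a local isometry) such that every vector `ξ` in the
range of the shared density matrix satisfies, for one vector `χ` of `H_A ⊗ H_B`,
`(VA ⊗ VB) (A'_x ⊗ B'_y) ξ = χ ⊗ (A_x ⊗ B_y) φ`,
where `A'`, `B'` are the observables of `s`, and `x`, `y` run over the two settings and the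
identity. For a pure state `|ξ⟩⟨ξ|` the range consists of the multiples of `ξ`. -/
def QuantumStrategy.IsLocallyEquivalentTo {ιA ιB : Type*} [Fintype ιA] [DecidableEq ιA]
    [Fintype ιB] [DecidableEq ιB] (s : QuantumStrategy ιA ιB)
    (φ : Fin 2 × Fin 2 → ℂ) (A B : Fin 2 → Matrix (Fin 2) (Fin 2) ℂ) : Prop :=
  ∃ (VA : Matrix (ιA × Fin 2) ιA ℂ) (VB : Matrix (ιB × Fin 2) ιB ℂ),
    VAᴴ * VA = 1 ∧ VBᴴ * VB = 1 ∧
      ∀ v : ιA × ιB → ℂ, ∃ χ : ιA × ιB → ℂ, ∀ x y : Option (Fin 2),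
        ∀ (i : ιA) (j : ιB) (k l : Fin 2),
          ((VA ⊗ₖ VB) *ᵥ ((withId s.A x ⊗ₖ withId s.B y) *ᵥ (s.ρ *ᵥ v))) ((i, k), (j, l)) =
            χ (i, j) * ((withId A x ⊗ₖ withId B y) *ᵥ φ) (k, l)

/-- The quantum value `((4w+5)√(4w+5) - (12w+11)) / (2(w+1))`. -/
noncomputable def hardyQuantumValue (w : ℝ) : ℝ :=
  ((4 * w + 5) * √(4 * w + 5) - (12 * w + 11)) / (2 * (w + 1))

/-- The strategy `s` passes the tilted Hardy test with the value `hardyQuantumValue w`. -/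
def QuantumStrategy.Attains {ιA ιB : Type*} [Fintype ιA] [DecidableEq ιA]
    [Fintype ιB] [DecidableEq ιB] (s : QuantumStrategy ιA ιB) (w : ℝ) : Prop :=
  HardyZero s.behavior ∧ hardyValue w s.behavior = hardyQuantumValue w

/-- The angle `θ = arcsin (3 - √(4w+5))`. -/
noncomputable def hardyAngle (w : ℝ) : ℝ :=
  Real.arcsin (3 - √(4 * w + 5))

/-- The state `cos(θ/2)|00⟩ - sin(θ/2)|11⟩`. -/
noncomputable def hardyState (θ : ℝ) : Fin 2 × Fin 2 → ℂ :=
  fun p =>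
    if p = (0, 0) then (Real.cos (θ / 2) : ℂ)
    else if p = (1, 1) then -(Real.sin (θ / 2) : ℂ)
    else 0

/-- The Pauli matrix `X`. -/
def pauliX : Matrix (Fin 2) (Fin 2) ℂ := !![0, 1; 1, 0]

/-- The Pauli matrix `Z`. -/
def pauliZ : Matrix (Fin 2) (Fin 2) ℂ := !![1, 0; 0, -1]

/-- The qubit observables, the same for both parties, of the optimal strategy. -/
noncomputable def hardyObs (θ : ℝ) : Fin 2 → Matrix (Fin 2) (Fin 2) ℂ :=
  ![((-((2 + Real.sin θ) * √(1 - Real.sin θ)) /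
          ((2 - Real.sin θ) * √(1 + Real.sin θ)) : ℝ) : ℂ) • pauliZ
      + ((-(√2 * Real.sin θ * √(Real.sin θ)) /
          ((2 - Real.sin θ) * √(1 + Real.sin θ)) : ℝ) : ℂ) • pauliX,
    ((-√(1 - Real.sin θ) / √(1 + Real.sin θ) : ℝ) : ℂ) • pauliZ
      + ((√2 * √(Real.sin θ) / √(1 + Real.sin θ) : ℝ) : ℂ) • pauliX]

/-- The two-qubit vector `φ` is entangled: it is not a product vector. -/
def IsEntangled (φ : Fin 2 × Fin 2 → ℂ) : Prop :=
  ¬ ∃ a b : Fin 2 → ℂ, ∀ i j, φ (i, j) = a i * b j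

/-- The two-qubit state `φ` is maximally entangled: its reduced state `Tr_B |φ⟩⟨φ|` is `1 / 2`. -/
def IsMaximallyEntangled (φ : Fin 2 × Fin 2 → ℂ) : Prop :=
  (Matrix.of fun i i' : Fin 2 => ∑ j, φ (i, j) * star (φ (i', j))) =
    (1 / 2 : ℂ) • (1 : Matrix (Fin 2) (Fin 2) ℂ)

/-! Write P₀, P₁ and Q₀, Q₁ for the outcome-0 projections of the two parties. A mixed state is a sum
of the vectors given by the columns of K, where ρ = K Kᴴ, so the bound is a statement about one
vector ξ with P₀(1−Q₁)ξ = (1−P₁)Q₀ξ = P₁Q₁ξ = 0.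

The operators T = (P₀−P₁)² and U = (Q₀−Q₁)² commute with all four projections. Their joint spectral
projections cut ξ into sectors T = σ, U = τ, where each party sees two projections at a fixed angle
with sin² equal to σ or τ. The zero constraints survive the cut, and inside a sector they fix all
weights by a single one (`CommutingProjections.sector_bound`). What is left is an inequality in two
real variables. It holds by an explicit nonnegative remainder that vanishes only at σ = τ = c
(`angle_bound`), where w = `tiltOf c`; the parameter c in (0,1) also removes the nested radicals.

At equality every column of K, hence the range of ρ, lies in the eigenspaces T = c and U = c. There
P₀ and P₁ are a qubit pair tensored with an identity, and `exists_swap_components` builds the local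
isometry that extracts this qubit. The zero constraints then determine the extracted two-qubit state
(`CommutingProjections.amplitude`, `exists_swap_isometries`). Conversely, local equivalence fixes
the behaviour.

All this is done for one standard model and for its images under local unitaries
(`IsStdModel.selfTest`). The explicit strategy is such an image under a rotation. By singular values
so is every entangled state that is not maximally entangled, since `stdState c` realizes every |det|
strictly between 0 and 1/2. -/

/-! ### Squared norms and projections. -/

section NormSq

variable {ι : Type*} [Fintype ι]

/-- The squared Euclidean norm of a complex vector. -/
noncomputable def nsq (v : ι → ℂ) : ℝ := ∑ i, Complex.normSq (v i)

theorem nsq_nonneg (v : ι → ℂ) : 0 ≤ nsq v :=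
  Finset.sum_nonneg fun _ _ => Complex.normSq_nonneg _

theorem nsq_eq_zero {v : ι → ℂ} : nsq v = 0 ↔ v = 0 := by
  unfold nsq
  rw [Finset.sum_eq_zero_iff_of_nonneg fun _ _ => Complex.normSq_nonneg _]
  simp [funext_iff]

@[simp] theorem nsq_zero : nsq (0 : ι → ℂ) = 0 := nsq_eq_zero.2 rfl

@[simp] theorem nsq_neg (v : ι → ℂ) : nsq (-v) = nsq v := by simp [nsq]

theorem star_dotProduct_self (v : ι → ℂ) : star v ⬝ᵥ v = (nsq v : ℂ) := by
  simp [nsq, dotProduct, Complex.normSq_eq_conj_mul_self]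

theorem nsq_eq_re (v : ι → ℂ) : nsq v = (star v ⬝ᵥ v).re := by
  rw [star_dotProduct_self, Complex.ofReal_re]

theorem star_mulVec_dotProduct (M : Matrix ι ι ℂ) (v w : ι → ℂ) :
    star (M *ᵥ v) ⬝ᵥ w = star v ⬝ᵥ (Mᴴ *ᵥ w) := by
  rw [Matrix.star_mulVec, Matrix.dotProduct_mulVec]

theorem nsq_mulVec (M : Matrix ι ι ℂ) (v : ι → ℂ) :
    nsq (M *ᵥ v) = (star v ⬝ᵥ ((Mᴴ * M) *ᵥ v)).re := by
  rw [nsq_eq_re, star_mulVec_dotProduct, Matrix.mulVec_mulVec]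

theorem IsStarProjection.conjTranspose_mul {P : Matrix ι ι ℂ} (hP : IsStarProjection P) :
    Pᴴ * P = P := by
  have h : Pᴴ = P := hP.isSelfAdjoint
  rw [h, hP.isIdempotentElem.eq]

theorem IsStarProjection.nsq_mulVec {P : Matrix ι ι ℂ} (hP : IsStarProjection P) (v : ι → ℂ) :
    nsq (P *ᵥ v) = (star v ⬝ᵥ (P *ᵥ v)).re := by
  rw [_root_.nsq_mulVec, hP.conjTranspose_mul]

theorem IsStarProjection.nsq_eq_add [DecidableEq ι] {P : Matrix ι ι ℂ} (hP : IsStarProjection P)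
    (v : ι → ℂ) : nsq v = nsq (P *ᵥ v) + nsq ((1 - P) *ᵥ v) := by
  rw [hP.nsq_mulVec, hP.one_sub.nsq_mulVec, nsq_eq_re, Matrix.sub_mulVec, Matrix.one_mulVec,
    dotProduct_sub, Complex.sub_re]
  ring

theorem sum_nsq_mulVec [DecidableEq ι] {κ : Type*} (S : Finset κ) (E : κ → Matrix ι ι ℂ)
    (hE : ∀ k, IsStarProjection (E k)) (hS : ∑ k ∈ S, E k = 1) (v : ι → ℂ) :
    ∑ k ∈ S, nsq (E k *ᵥ v) = nsq v := by
  simp_rw [fun k => (hE k).nsq_mulVec v]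
  rw [← Complex.re_sum, ← dotProduct_sum, ← Matrix.sum_mulVec, hS, Matrix.one_mulVec, nsq_eq_re]

end NormSq

/-! ### Spectral projections and factorization of the state. -/

section Spectral

variable {ι : Type*} [Fintype ι] [DecidableEq ι]

theorem Matrix.IsHermitian.exists_diagonalization {C : Matrix ι ι ℂ} (hC : C.IsHermitian) :
    ∃ U : Matrix ι ι ℂ, U * Uᴴ = 1 ∧ Uᴴ * U = 1 ∧
      C = U * Matrix.diagonal (fun i => (hC.eigenvalues i : ℂ)) * Uᴴ := by
  refine ⟨hC.eigenvectorUnitary, ?_, ?_, ?_⟩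
  · exact Unitary.coe_mul_star_self hC.eigenvectorUnitary
  · exact Unitary.coe_star_mul_self hC.eigenvectorUnitary
  · exact hC.spectral_theorem

/-- The spectral projections of a Hermitian matrix. -/
theorem Matrix.IsHermitian.exists_spectralProjections {C : Matrix ι ι ℂ} (hC : C.IsHermitian) :
    ∃ (S : Finset ℝ) (E : ℝ → Matrix ι ι ℂ),
      (∀ μ, IsStarProjection (E μ)) ∧ (∀ μ, C * E μ = (μ : ℂ) • E μ) ∧
      (∀ M, Commute M C → ∀ μ, Commute M (E μ)) ∧ (∑ μ ∈ S, E μ = 1) ∧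
      ∀ μ : ℝ, ∃ G, 1 - E μ = G * (C - (μ : ℂ) • 1) := by
  obtain ⟨U, hU, hU', hCU⟩ := hC.exists_diagonalization
  set l := hC.eigenvalues with hl
  -- Functional calculus in the eigenbasis: F respects products, sums and scalars, so most clauses
  -- become pointwise identities of functions of the eigenvalue.
  let F : (ι → ℂ) → Matrix ι ι ℂ := fun f => U * Matrix.diagonal f * Uᴴ
  have hF : C = F fun i => (l i : ℂ) := hCU
  have hmul : ∀ f g, F f * F g = F (f * g) := by
    intro f g
    calc F f * F g = U * Matrix.diagonal f * (Uᴴ * U) * Matrix.diagonal g * Uᴴ := by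
          simp only [F, Matrix.mul_assoc]
      _ = F (f * g) := by
          rw [hU', Matrix.mul_one, Matrix.mul_assoc U, Matrix.diagonal_mul_diagonal]; rfl
  have hone : F 1 = 1 := by
    simp only [F, Matrix.diagonal_one', Matrix.mul_one, hU]
  have hsmul : ∀ (a : ℂ) f, F (a • f) = a • F f := by
    intro a f
    simp only [F, Matrix.diagonal_smul, Matrix.mul_smul, Matrix.smul_mul]
  have hsub : ∀ f g, F (f - g) = F f - F g := by
    intro f g
    have : Matrix.diagonal (f - g) = Matrix.diagonal f - Matrix.diagonal g := by
      rw [Matrix.diagonal_sub]; rfl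
    simp only [F, this, Matrix.mul_sub, Matrix.sub_mul]
  have hsum : ∀ (S : Finset ℝ) (f : ℝ → ι → ℂ), F (∑ k ∈ S, f k) = ∑ k ∈ S, F (f k) := by
    intro S f
    have : Matrix.diagonal (∑ k ∈ S, f k) = ∑ k ∈ S, Matrix.diagonal (f k) := by
      ext i j
      rw [Matrix.sum_apply]
      by_cases h : i = j
      · subst h; simp
      · simp [h]
    simp only [F, this, Matrix.mul_sum, Matrix.sum_mul]
  refine ⟨Finset.univ.image l, fun μ => F fun i => if l i = μ then 1 else 0, ?_, ?_, ?_, ?_, ?_⟩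
  · intro μ
    constructor
    · rw [IsIdempotentElem, hmul]
      congr 1
      ext i
      simp
    · rw [IsSelfAdjoint, Matrix.star_eq_conjTranspose]
      simp only [F, Matrix.conjTranspose_mul, Matrix.conjTranspose_conjTranspose,
        Matrix.diagonal_conjTranspose, Matrix.mul_assoc]
      congr 3
      ext i
      simp [apply_ite]
  · intro μ
    rw [hF, hmul, ← hsmul]
    congr 1
    ext i
    by_cases h : l i = μ <;> simp [h]
  · intro M hM μ
    -- In the eigenbasis, commuting with C means having no entries between different eigenvalues,
    -- and then M commutes with every function of the eigenvalue.
    have key : ∀ f, M * F f = F f * M ↔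
        (Uᴴ * M * U) * Matrix.diagonal f = Matrix.diagonal f * (Uᴴ * M * U) := by
      intro f
      have e1 : (Uᴴ * M * U) * Matrix.diagonal f = Uᴴ * (M * F f) * U := by
        simp only [F, Matrix.mul_assoc, hU', Matrix.mul_one]
      have e2 : Matrix.diagonal f * (Uᴴ * M * U) = Uᴴ * (F f * M) * U := by
        calc _ = (Uᴴ * U) * Matrix.diagonal f * (Uᴴ * M * U) := by rw [hU', Matrix.one_mul]
          _ = _ := by simp only [F, Matrix.mul_assoc]
      rw [e1, e2]
      refine ⟨fun h => by rw [h], fun h => ?_⟩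
      have h2 := congrArg (fun X => U * X * Uᴴ) h
      have e3 : ∀ X : Matrix ι ι ℂ, U * (Uᴴ * X * U) * Uᴴ = X := by
        intro X
        calc _ = (U * Uᴴ) * X * (U * Uᴴ) := by simp only [Matrix.mul_assoc]
          _ = X := by rw [hU, Matrix.one_mul, Matrix.mul_one]
      simpa only [e3] using h2
    have h := (key _).1 (hF ▸ hM.eq)
    refine (key _).2 ?_
    ext i j
    have hij := congrFun (congrFun h i) j
    simp only [Matrix.mul_diagonal, Matrix.diagonal_mul] at hij ⊢
    by_cases h0 : (Uᴴ * M * U) i j = 0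
    · simp [h0]
    · have : l i = l j := by
        have h1 : ((l j : ℝ) : ℂ) = l i := mul_left_cancel₀ h0 (by rw [hij, mul_comm])
        exact_mod_cast h1.symm
      rw [this, mul_comm]
  · rw [← hsum, ← hone]
    congr 1
    ext i
    simp [Finset.sum_apply]
  · intro μ
    -- The reduced resolvent at μ. A factorization, unlike a statement about eigenvectors, can be
    -- tensored with an identity.
    refine ⟨F fun i => if l i = μ then 0 else ((l i : ℂ) - μ)⁻¹, ?_⟩
    rw [hF, ← hone, ← hsmul, ← hsub, ← hsub, hmul]
    congr 1
    ext i
    by_cases h : l i = μ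
    · simp [h]
    · have : (l i : ℂ) - μ ≠ 0 := by
        rw [sub_ne_zero]; exact_mod_cast h
      simp [h, this]

/-- A positive semidefinite matrix factors as `K Kᴴ` with the columns of `K` in its range. -/
theorem Matrix.PosSemidef.exists_factorization {ρ : Matrix ι ι ℂ} (hρ : ρ.PosSemidef) :
    ∃ K L : Matrix ι ι ℂ, ρ = K * Kᴴ ∧ K = ρ * L := by
  obtain ⟨U, hU, hU', h⟩ := hρ.1.exists_diagonalization
  have h0 := hρ.eigenvalues_nonneg
  set l := hρ.1.eigenvalues
  -- K = U√D and L = U D^(−1/2); on the kernel the convention 0⁻¹ = 0 gives zero columns on both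
  -- sides.
  refine ⟨U * Matrix.diagonal fun i => (√(l i) : ℂ),
    U * Matrix.diagonal fun i => ((√(l i))⁻¹ : ℂ), ?_, ?_⟩
  · rw [h, Matrix.conjTranspose_mul, Matrix.diagonal_conjTranspose]
    have : Matrix.diagonal (fun i => (l i : ℂ)) =
        (Matrix.diagonal fun i => (√(l i) : ℂ)) *
          Matrix.diagonal (star fun i => (√(l i) : ℂ)) := by
      rw [Matrix.diagonal_mul_diagonal]
      congr 1
      ext i
      simp only [Pi.star_apply, RCLike.star_def, Complex.conj_ofReal]
      rw [← Complex.ofReal_mul, Real.mul_self_sqrt (h0 i)]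
    rw [this]
    simp only [Matrix.mul_assoc]
  · rw [h]
    calc _ = U * (Matrix.diagonal (fun i => (l i : ℂ)) *
          Matrix.diagonal fun i => ((√(l i))⁻¹ : ℂ)) := by
          rw [Matrix.diagonal_mul_diagonal]
          congr 2
          ext i
          by_cases hz : √(l i) = 0
          · simp [hz]
          · have : (l i : ℂ) = √(l i) * √(l i) := by
              rw [← Complex.ofReal_mul, Real.mul_self_sqrt (h0 i)]
            have hz' : (√(l i) : ℂ) ≠ 0 := by exact_mod_cast hz
            rw [this]
            field_simp
      _ = U * Matrix.diagonal (fun i => (l i : ℂ)) * (Uᴴ * U) *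
          Matrix.diagonal fun i => ((√(l i))⁻¹ : ℂ) := by
          rw [hU', Matrix.mul_one, Matrix.mul_assoc]
      _ = _ := by simp only [Matrix.mul_assoc]

omit [DecidableEq ι] in
theorem trace_mul_mul_conjTranspose (M K : Matrix ι ι ℂ) :
    (M * (K * Kᴴ)).trace = ∑ i, star (K.col i) ⬝ᵥ (M *ᵥ K.col i) := by
  rw [← Matrix.mul_assoc, Matrix.trace_mul_comm, Matrix.trace]
  rfl

end Spectral

/-! ### The optimization over two angles. -/

section RealBound

/-- The tilt `w` whose optimal strategy has `sin² = c` for the angle between the observables. -/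
noncomputable def tiltOf (c : ℝ) : ℝ := (1 - c - c ^ 2) / (1 + c) ^ 2

/-- The optimal value at the tilt `tiltOf c`. -/
noncomputable def valueOf (c : ℝ) : ℝ := (1 - c) ^ 2 / (1 + c)

theorem valueOf_pos {c : ℝ} (h0 : 0 < c) (h1 : c < 1) : 0 < valueOf c := by
  have : 0 < 1 - c := by linarith
  unfold valueOf
  positivity

theorem valueOf_sub_tiltOf {c : ℝ} (h0 : 0 < c) :
    valueOf c - tiltOf c = c ^ 3 / (1 + c) ^ 2 := by
  have : 1 + c ≠ 0 := by positivity
  unfold valueOf tiltOf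
  field_simp
  ring

theorem tiltOf_lt_valueOf {c : ℝ} (h0 : 0 < c) : tiltOf c < valueOf c := by
  have h := valueOf_sub_tiltOf h0
  have : 0 < c ^ 3 / (1 + c) ^ 2 := by positivity
  linarith

/-- The optimization over pairs of angles, with `σ` and `τ` the squared sines. -/
theorem angle_bound {c σ τ : ℝ} (hc0 : 0 < c) (hσ : 0 ≤ σ) (hσ1 : σ < 1)
    (hτ : 0 ≤ τ) (hτ1 : τ < 1) :
    (1 - σ) * (1 - τ) * (σ * τ) + tiltOf c * (1 - σ * τ) ^ 2 ≤ valueOf c * (1 - σ * τ) ∧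
    ((1 - σ) * (1 - τ) * (σ * τ) + tiltOf c * (1 - σ * τ) ^ 2 = valueOf c * (1 - σ * τ) →
      σ = c ∧ τ = c) := by
  -- With square roots, (1−x²)(1−z²) = (1−xz)² − (x−z)², so the gap splits into a function of the
  -- product xz and a penalty for x ≠ z.
  obtain ⟨x, hx0, rfl⟩ : ∃ x, 0 ≤ x ∧ σ = x ^ 2 := ⟨√σ, Real.sqrt_nonneg _, (Real.sq_sqrt hσ).symm⟩
  obtain ⟨z, hz0, rfl⟩ : ∃ z, 0 ≤ z ∧ τ = z ^ 2 := ⟨√τ, Real.sqrt_nonneg _, (Real.sq_sqrt hτ).symm⟩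
  have hx1 : x < 1 := by nlinarith
  have hz1 : z < 1 := by nlinarith
  have hy1 : 0 < 1 - x * z := by nlinarith
  have hy0 : 0 ≤ x * z := mul_nonneg hx0 hz0
  have hc : 1 + c ≠ 0 := by positivity
  -- For y = xz the first part is (1−y) times a cubic in y; `tiltOf c` and `valueOf c` are the
  -- coefficients that give this cubic a double zero at y = c.
  have key : valueOf c * (1 - x ^ 2 * z ^ 2) - ((1 - x ^ 2) * (1 - z ^ 2) * (x ^ 2 * z ^ 2) +
      tiltOf c * (1 - x ^ 2 * z ^ 2) ^ 2) =
      (1 - x * z) * ((x * z - c) ^ 2 * (c + 2 * (x * z) + c * (x * z)) / (1 + c) ^ 2) +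
        (x - z) ^ 2 * (x * z) ^ 2 := by
    unfold valueOf tiltOf
    field_simp
    ring
  have hp : 0 < c + 2 * (x * z) + c * (x * z) := by positivity
  have t1 : 0 ≤ (1 - x * z) * ((x * z - c) ^ 2 * (c + 2 * (x * z) + c * (x * z)) / (1 + c) ^ 2) := by
    positivity
  have t2 : 0 ≤ (x - z) ^ 2 * (x * z) ^ 2 := by positivity
  refine ⟨by linarith, fun h => ?_⟩
  have e1 : (1 - x * z) * ((x * z - c) ^ 2 * (c + 2 * (x * z) + c * (x * z)) / (1 + c) ^ 2) = 0 := by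
    linarith
  have e2 : (x - z) ^ 2 * (x * z) ^ 2 = 0 := by linarith
  have hxz : x * z = c := by
    have h2 : (1 + c) ^ 2 ≠ 0 := pow_ne_zero _ hc
    have : (x * z - c) ^ 2 = 0 := by
      simpa [hy1.ne', hp.ne', hc] using e1
    nlinarith [pow_eq_zero_iff (two_ne_zero) |>.1 this]
  have hxe : x = z := by
    rw [hxz] at e2
    have : (x - z) ^ 2 = 0 := by simpa [hc0.ne'] using e2
    linarith [pow_eq_zero_iff (two_ne_zero) |>.1 this]
  subst hxe
  constructor <;> nlinarith

/-- The bound for the weights of one pair of angles. -/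
theorem weighted_angle_bound {c σ τ n n₁ n₂ : ℝ} (hc0 : 0 < c) (hc1 : c < 1) (hσ : 0 ≤ σ)
    (hσ1 : σ ≤ 1) (hτ : 0 ≤ τ) (hτ1 : τ ≤ 1) (hn : 0 ≤ n) (hn₁ : 0 ≤ n₁) (hn₂ : 0 ≤ n₂)
    (h₁ : (1 - σ) * n₁ = σ * n) (h₂ : (1 - τ) * n₂ = τ * n) :
    σ * τ * n + tiltOf c * (n * (1 + σ * τ) + (1 - τ) * n₁ + (1 - σ) * n₂) ≤
      valueOf c * (n + n₁ + n₂) ∧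
    (σ * τ * n + tiltOf c * (n * (1 + σ * τ) + (1 - τ) * n₁ + (1 - σ) * n₂) =
      valueOf c * (n + n₁ + n₂) → n + n₁ + n₂ = 0 ∨ (σ = c ∧ τ = c)) := by
  have hq := valueOf_pos hc0 hc1
  have hwq := tiltOf_lt_valueOf hc0
  -- The cases σ = 1 or τ = 1, where the weights cannot be divided out. There n = 0, and since the
  -- tilt is strictly below the positive value, equality needs zero total weight.
  have edge : ∀ b N M : ℝ, 0 ≤ b → b ≤ 1 → 0 ≤ N → 0 ≤ M → b * M = 0 →
      tiltOf c * (b * N) ≤ valueOf c * (N + M) ∧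
      (tiltOf c * (b * N) = valueOf c * (N + M) → N + M = 0) := by
    intro b N M hb hb1 hN hM hbM
    have hbN : 0 ≤ b * N := mul_nonneg hb hN
    have hbN1 : b * N ≤ N := by nlinarith
    have s1 : tiltOf c * (b * N) ≤ valueOf c * (b * N) := by nlinarith
    have s2 : valueOf c * (b * N) ≤ valueOf c * N := by nlinarith
    have s3 : 0 ≤ valueOf c * M := by positivity
    refine ⟨by nlinarith, fun h => ?_⟩
    have m0 : valueOf c * M = 0 := by nlinarith
    have m1 : M = 0 := by simpa [hq.ne'] using m0
    have m2 : (valueOf c - tiltOf c) * (b * N) = 0 := by nlinarith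
    have m3 : b * N = 0 := by simpa [(sub_pos.2 hwq).ne'] using m2
    rw [m3, m1] at h
    have : N = 0 := by
      have : valueOf c * N = 0 := by linarith
      simpa [hq.ne'] using this
    rw [this, m1, add_zero]
  rcases hσ1.eq_or_lt with rfl | hσ1
  · have hn0 : n = 0 := by linarith
    subst hn0
    have := edge (1 - τ) n₁ n₂ (by linarith) (by linarith) hn₁ hn₂ (by linarith)
    simp only [mul_zero, zero_mul, zero_add, sub_self, add_zero]
    exact ⟨this.1, fun h => Or.inl (this.2 h)⟩
  rcases hτ1.eq_or_lt with rfl | hτ1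
  · have hn0 : n = 0 := by linarith
    subst hn0
    have := edge (1 - σ) n₂ n₁ (by linarith) (by linarith) hn₂ hn₁ (by linarith)
    simp only [mul_zero, zero_mul, zero_add, sub_self, add_zero]
    rw [add_comm n₁ n₂]
    exact ⟨this.1, fun h => Or.inl (this.2 h)⟩
  have ha : 0 < 1 - σ := by linarith
  have hb : 0 < 1 - τ := by linarith
  have e₁ : n₁ = σ * n / (1 - σ) := by rw [eq_div_iff ha.ne']; linarith
  have e₂ : n₂ = τ * n / (1 - τ) := by rw [eq_div_iff hb.ne']; linarith
  obtain ⟨i1, i2⟩ := angle_bound hc0 hσ hσ1 hτ hτ1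
  -- After solving for n₁ and n₂ the gap is a nonnegative multiple of the one in `angle_bound`.
  have key : valueOf c * (n + n₁ + n₂) -
      (σ * τ * n + tiltOf c * (n * (1 + σ * τ) + (1 - τ) * n₁ + (1 - σ) * n₂)) =
      n / ((1 - σ) * (1 - τ)) * (valueOf c * (1 - σ * τ) -
        ((1 - σ) * (1 - τ) * (σ * τ) + tiltOf c * (1 - σ * τ) ^ 2)) := by
    rw [e₁, e₂]
    field_simp
    ring
  have hnn : 0 ≤ n / ((1 - σ) * (1 - τ)) := by positivity
  constructor
  · have := mul_nonneg hnn (sub_nonneg.2 i1)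
    linarith
  · intro h
    rw [h, sub_self, eq_comm, mul_eq_zero] at key
    rcases key with k | k
    · left
      have : n = 0 := by simpa [ha.ne', hb.ne'] using k
      rw [e₁, e₂, this]; simp
    · right
      exact i2 (by linarith)

end RealBound

/-! ### Two projections per party: sectors and the bound for vectors. -/

section Sector

variable {ι : Type*} [Fintype ι] [DecidableEq ι]

/-- Where (P₀−P₁)² acts as σ, P₀ compressed to the range of P₁ is the scalar 1−σ, the cos² of the
angle. -/
theorem sq_sub_conj {P₀ P₁ : Matrix ι ι ℂ} (h₁ : P₁ * P₁ = P₁) (h₀ : P₀ * P₀ = P₀) :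
    P₁ * P₀ * P₁ = P₁ * (1 - (P₀ - P₁) * (P₀ - P₁)) := by
  simp only [mul_sub, sub_mul, mul_one, ← mul_assoc, h₁]
  simp only [mul_assoc, h₀]
  abel

theorem sq_sub_conj_compl {P₀ P₁ : Matrix ι ι ℂ} (h₁ : P₁ * P₁ = P₁) (h₀ : P₀ * P₀ = P₀) :
    (1 - P₁) * P₀ * (1 - P₁) = (1 - P₁) * ((P₀ - P₁) * (P₀ - P₁)) := by
  simp only [mul_sub, sub_mul, mul_one, one_mul, ← mul_assoc, h₁]
  simp only [mul_assoc, h₀]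
  abel

omit [DecidableEq ι] in
-- Both P₀(P₀−P₁)² and (P₀−P₁)²P₀ equal P₀ − P₀P₁P₀, and likewise for P₁. Sectors are therefore
-- invariant under both projections.
theorem commute_sq_sub {P₀ P₁ : Matrix ι ι ℂ} (h₁ : P₁ * P₁ = P₁) (h₀ : P₀ * P₀ = P₀) :
    Commute P₀ ((P₀ - P₁) * (P₀ - P₁)) ∧ Commute P₁ ((P₀ - P₁) * (P₀ - P₁)) := by
  constructor <;> rw [Commute, SemiconjBy] <;>
  · simp only [mul_sub, sub_mul, ← mul_assoc, h₁, h₀]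
    simp only [mul_assoc, h₁, h₀]
    abel

variable {P₀ P₁ Q₀ Q₁ : Matrix ι ι ℂ}

theorem nsq_mulVec_of_sector (h₀ : IsStarProjection P₀) (h₁ : IsStarProjection P₁) {σ : ℝ}
    {v : ι → ℂ} (hv : ((P₀ - P₁) * (P₀ - P₁)) *ᵥ v = (σ : ℂ) • v) :
    nsq (P₀ *ᵥ (P₁ *ᵥ v)) = (1 - σ) * nsq (P₁ *ᵥ v) := by
  have e : P₁ᴴ = P₁ := h₁.isSelfAdjoint
  rw [h₀.nsq_mulVec, star_mulVec_dotProduct, Matrix.mulVec_mulVec, Matrix.mulVec_mulVec, e,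
    sq_sub_conj h₁.isIdempotentElem.eq h₀.isIdempotentElem.eq,
    ← Matrix.mulVec_mulVec, Matrix.sub_mulVec, hv, Matrix.one_mulVec, h₁.nsq_mulVec,
    Matrix.mulVec_sub, Matrix.mulVec_smul, dotProduct_sub, dotProduct_smul, Complex.sub_re,
    smul_eq_mul, Complex.re_ofReal_mul]
  ring

theorem nsq_compl_mulVec_of_sector (h₀ : IsStarProjection P₀) (h₁ : IsStarProjection P₁) {σ : ℝ}
    {v : ι → ℂ} (hv : ((P₀ - P₁) * (P₀ - P₁)) *ᵥ v = (σ : ℂ) • v) :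
    nsq (P₀ *ᵥ ((1 - P₁) *ᵥ v)) = σ * nsq ((1 - P₁) *ᵥ v) := by
  have e : (1 - P₁)ᴴ = 1 - P₁ := h₁.one_sub.isSelfAdjoint
  rw [h₀.nsq_mulVec, star_mulVec_dotProduct, Matrix.mulVec_mulVec, Matrix.mulVec_mulVec, e,
    sq_sub_conj_compl h₁.isIdempotentElem.eq h₀.isIdempotentElem.eq,
    ← Matrix.mulVec_mulVec, hv, h₁.one_sub.nsq_mulVec,
    Matrix.mulVec_smul, dotProduct_smul,
    smul_eq_mul, Complex.re_ofReal_mul]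

/-- The Hermitian matrices P₀−P₁ and 1−P₀−P₁ have squares that add up to 1, so σ and 1−σ are both
ratios of squared norms. -/
theorem sector_mem_Icc (h₀ : IsStarProjection P₀) (h₁ : IsStarProjection P₁) {σ : ℝ}
    {v : ι → ℂ} (hv : ((P₀ - P₁) * (P₀ - P₁)) *ᵥ v = (σ : ℂ) • v) (hv0 : v ≠ 0) :
    0 ≤ σ ∧ σ ≤ 1 := by
  have hpos : 0 < nsq v := (nsq_nonneg v).lt_of_ne fun h => hv0 (nsq_eq_zero.1 h.symm)
  have e₀ : P₀ᴴ = P₀ := h₀.isSelfAdjoint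
  have e₁ : P₁ᴴ = P₁ := h₁.isSelfAdjoint
  have a : nsq ((P₀ - P₁) *ᵥ v) = σ * nsq v := by
    rw [nsq_mulVec, Matrix.conjTranspose_sub, e₀, e₁, hv, dotProduct_smul, smul_eq_mul,
      Complex.re_ofReal_mul, nsq_eq_re]
  have b : nsq ((1 - P₀ - P₁) *ᵥ v) = (1 - σ) * nsq v := by
    have : (1 - P₀ - P₁) * (1 - P₀ - P₁) = 1 - (P₀ - P₁) * (P₀ - P₁) := by
      simp only [mul_sub, sub_mul, mul_one, one_mul, h₀.isIdempotentElem.eq,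
        h₁.isIdempotentElem.eq]
      abel
    rw [nsq_mulVec, Matrix.conjTranspose_sub, Matrix.conjTranspose_sub, Matrix.conjTranspose_one,
      e₀, e₁, this, Matrix.sub_mulVec, hv, Matrix.one_mulVec, dotProduct_sub, dotProduct_smul,
      smul_eq_mul, Complex.sub_re, Complex.re_ofReal_mul, nsq_eq_re]
    ring
  have ha := nsq_nonneg ((P₀ - P₁) *ᵥ v)
  have hb := nsq_nonneg ((1 - P₀ - P₁) *ᵥ v)
  rw [a] at ha
  rw [b] at hb
  exact ⟨nonneg_of_mul_nonneg_left ha hpos, by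
    linarith [nonneg_of_mul_nonneg_left hb hpos]⟩

/-- The commuting projections of the two parties on a common space. -/
structure CommutingProjections (P₀ P₁ Q₀ Q₁ : Matrix ι ι ℂ) : Prop where
  p₀ : IsStarProjection P₀
  p₁ : IsStarProjection P₁
  q₀ : IsStarProjection Q₀
  q₁ : IsStarProjection Q₁
  c₀₀ : Commute P₀ Q₀
  c₀₁ : Commute P₀ Q₁
  c₁₀ : Commute P₁ Q₀
  c₁₁ : Commute P₁ Q₁

/-- The vector `ξ` satisfies the Hardy zero constraints. -/
def HardyVector (P₀ P₁ Q₀ Q₁ : Matrix ι ι ℂ) (ξ : ι → ℂ) : Prop :=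
  (P₀ * (1 - Q₁)) *ᵥ ξ = 0 ∧ ((1 - P₁) * Q₀) *ᵥ ξ = 0 ∧ (P₁ * Q₁) *ᵥ ξ = 0

/-- The unnormalized tilted Hardy value of the vector `ξ`. -/
noncomputable def vectorValue (w : ℝ) (P₀ Q₀ : Matrix ι ι ℂ) (ξ : ι → ℂ) : ℝ :=
  nsq ((P₀ * Q₀) *ᵥ ξ) + w * nsq (((1 - P₀) * (1 - Q₀)) *ᵥ ξ)

omit [DecidableEq ι] in
theorem CommutingProjections.symm (h : CommutingProjections P₀ P₁ Q₀ Q₁) :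
    CommutingProjections Q₀ Q₁ P₀ P₁ :=
  ⟨h.q₀, h.q₁, h.p₀, h.p₁, h.c₀₀.symm, h.c₁₀.symm, h.c₀₁.symm, h.c₁₁.symm⟩

theorem CommutingProjections.hardyVector_symm (h : CommutingProjections P₀ P₁ Q₀ Q₁) {ξ : ι → ℂ}
    (hξ : HardyVector P₀ P₁ Q₀ Q₁ ξ) : HardyVector Q₀ Q₁ P₀ P₁ ξ := by
  obtain ⟨z₁, z₂, z₃⟩ := hξ
  refine ⟨?_, ?_, ?_⟩
  · rwa [← ((Commute.one_left Q₀).sub_left h.c₁₀).eq]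
  · rwa [← ((Commute.one_right P₀).sub_right h.c₀₁).eq]
  · rwa [← h.c₁₁.eq]

/-- The vector identities behind the zero constraints, for one party. -/
theorem HardyVector.identities
    {ξ : ι → ℂ} (hξ : HardyVector P₀ P₁ Q₀ Q₁ ξ) :
    P₀ *ᵥ ξ = P₀ *ᵥ (Q₁ *ᵥ ξ) ∧ (1 - P₁) *ᵥ (Q₁ *ᵥ ξ) = Q₁ *ᵥ ξ ∧
      P₀ *ᵥ ((1 - P₁) *ᵥ ((1 - Q₁) *ᵥ ξ)) = -(P₀ *ᵥ (P₁ *ᵥ ξ)) := by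
  obtain ⟨z₁, z₂, z₃⟩ := hξ
  have z₃' : P₁ *ᵥ (Q₁ *ᵥ ξ) = 0 := by rw [Matrix.mulVec_mulVec, z₃]
  have a : P₀ *ᵥ ξ = P₀ *ᵥ (Q₁ *ᵥ ξ) := by
    have z := z₁
    rw [← Matrix.mulVec_mulVec, Matrix.sub_mulVec, Matrix.one_mulVec, Matrix.mulVec_sub,
      sub_eq_zero] at z
    exact z
  refine ⟨a, ?_, ?_⟩
  · rw [Matrix.sub_mulVec, Matrix.one_mulVec, z₃', sub_zero]
  -- Expanding the product, P₀ξ cancels P₀Q₁ξ and P₀P₁Q₁ξ vanishes, so only −P₀P₁ξ remains.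
  · simp only [Matrix.sub_mulVec, Matrix.one_mulVec, Matrix.mulVec_sub, z₃', ← a, Matrix.mulVec_zero]
    abel

omit [DecidableEq ι] in
theorem mulVec_sector {M : Matrix ι ι ℂ} {T : Matrix ι ι ℂ} (h : Commute M T) {a : ℂ} {v : ι → ℂ}
    (hv : T *ᵥ v = a • v) : T *ᵥ (M *ᵥ v) = a • (M *ᵥ v) := by
  rw [Matrix.mulVec_mulVec, ← h.eq, ← Matrix.mulVec_mulVec, hv, Matrix.mulVec_smul]

omit [DecidableEq ι] in
theorem Commute.sq_sub {M P Q : Matrix ι ι ℂ} (h₀ : Commute M P) (h₁ : Commute M Q) :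
    Commute M ((P - Q) * (P - Q)) :=
  (h₀.sub_right h₁).mul_right (h₀.sub_right h₁)

/-- One half of the weight relations in a joint sector. -/
theorem CommutingProjections.sector_weights (h : CommutingProjections P₀ P₁ Q₀ Q₁)
    {ξ : ι → ℂ} (hξ : HardyVector P₀ P₁ Q₀ Q₁ ξ) {σ : ℝ}
    (hσ : ((P₀ - P₁) * (P₀ - P₁)) *ᵥ ξ = (σ : ℂ) • ξ) :
    (1 - σ) * nsq (P₁ *ᵥ ξ) = σ * nsq ((1 - P₁) *ᵥ ((1 - Q₁) *ᵥ ξ)) ∧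
      nsq (P₀ *ᵥ ξ) = σ * nsq (Q₁ *ᵥ ξ) := by
  obtain ⟨i₁, i₂, i₃⟩ := hξ.identities
  constructor
  -- Both sides are the squared norm of P₀P₁ξ, computed directly and through the third identity.
  · rw [← nsq_mulVec_of_sector h.p₀ h.p₁ hσ, ← nsq_compl_mulVec_of_sector h.p₀ h.p₁, i₃, nsq_neg]
    exact mulVec_sector (((Commute.one_left _).sub_left (h.c₀₁.symm.sq_sub h.c₁₁.symm))) hσ
  · rw [i₁]
    conv_lhs => rw [← i₂]
    conv_rhs => rw [← i₂]
    exact nsq_compl_mulVec_of_sector h.p₀ h.p₁ (mulVec_sector (h.c₀₁.symm.sq_sub h.c₁₁.symm) hσ)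

/-- Since P₁Q₁ξ = 0, ξ is the orthogonal sum of (1−P₁)(1−Q₁)ξ, P₁ξ and Q₁ξ. Within a joint sector
the value is a combination of their three squared norms, and `weighted_angle_bound` applies. -/
theorem CommutingProjections.sector_bound (h : CommutingProjections P₀ P₁ Q₀ Q₁)
    {ξ : ι → ℂ} (hξ : HardyVector P₀ P₁ Q₀ Q₁ ξ) {c σ τ : ℝ} (hc0 : 0 < c) (hc1 : c < 1)
    (hσ : ((P₀ - P₁) * (P₀ - P₁)) *ᵥ ξ = (σ : ℂ) • ξ)
    (hτ : ((Q₀ - Q₁) * (Q₀ - Q₁)) *ᵥ ξ = (τ : ℂ) • ξ) :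
    vectorValue (tiltOf c) P₀ Q₀ ξ ≤ valueOf c * nsq ξ ∧
    (vectorValue (tiltOf c) P₀ Q₀ ξ = valueOf c * nsq ξ → ξ = 0 ∨ (σ = c ∧ τ = c)) := by
  by_cases h0 : ξ = 0
  · subst h0
    simp [vectorValue]
  have hξ' := h.hardyVector_symm hξ
  obtain ⟨hσ0, hσ1⟩ := sector_mem_Icc h.p₀ h.p₁ hσ h0
  obtain ⟨hτ0, hτ1⟩ := sector_mem_Icc h.q₀ h.q₁ hτ h0
  obtain ⟨a₁, a₂⟩ := h.sector_weights hξ hσ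
  obtain ⟨b₁, b₂⟩ := h.symm.sector_weights hξ' hτ
  obtain ⟨i₁, i₂, i₃⟩ := hξ.identities
  obtain ⟨j₁, j₂, j₃⟩ := hξ'.identities
  have cmp : ∀ {M N : Matrix ι ι ℂ}, Commute M N → ∀ v, M *ᵥ (N *ᵥ v) = N *ᵥ (M *ᵥ v) := by
    intro M N hMN v
    rw [Matrix.mulVec_mulVec, hMN.eq, ← Matrix.mulVec_mulVec]
  have cp : ∀ {M N : Matrix ι ι ℂ}, Commute M N → Commute M (1 - N) := fun hMN =>
    (Commute.one_right _).sub_right hMN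
  rw [cmp (cp (cp h.c₁₁).symm)] at b₁
  set n := nsq ((1 - P₁) *ᵥ ((1 - Q₁) *ᵥ ξ)) with hn
  set n₁ := nsq (P₁ *ᵥ ξ) with hn₁
  set n₂ := nsq (Q₁ *ᵥ ξ) with hn₂
  have htot : nsq ξ = n + n₁ + n₂ := by
    rw [h.p₁.nsq_eq_add ξ, h.q₁.nsq_eq_add ((1 - P₁) *ᵥ ξ), cmp (cp h.c₁₁.symm), i₂,
      cmp (cp (cp h.c₁₁).symm)]
    ring
  have h00 : nsq (P₀ *ᵥ (Q₀ *ᵥ ξ)) = σ * τ * n := by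
    -- First Q₀ξ = Q₀P₁ξ, then P₀P₁ξ is rewritten by the third identity. Both parties now act on
    -- their complements, which yields the factors σ and τ.
    have e : P₀ *ᵥ (Q₀ *ᵥ ξ) = -(P₀ *ᵥ ((1 - P₁) *ᵥ (Q₀ *ᵥ ((1 - Q₁) *ᵥ ξ)))) := by
      rw [j₁, cmp h.c₀₀, ← neg_neg (P₀ *ᵥ (P₁ *ᵥ ξ)), ← i₃, Matrix.mulVec_neg, ← cmp h.c₀₀,
        cmp (cp h.c₁₀.symm)]
    rw [e, nsq_neg, nsq_compl_mulVec_of_sector h.p₀ h.p₁ (σ := σ), cmp (cp h.c₁₀.symm).symm,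
      cmp (cp (cp h.c₁₁).symm).symm, nsq_compl_mulVec_of_sector h.q₀ h.q₁ (σ := τ),
      cmp (cp (cp h.c₁₁).symm), ← hn]
    · ring
    · exact mulVec_sector ((Commute.one_left _).sub_left (h.c₁₀.sq_sub h.c₁₁)) hτ
    · exact mulVec_sector (h.c₀₀.symm.sq_sub h.c₁₀.symm)
        (mulVec_sector ((Commute.one_left _).sub_left (h.c₀₁.symm.sq_sub h.c₁₁.symm)) hσ)
  -- Inclusion–exclusion, with ‖P₀ξ‖² = σn₂ and ‖Q₀ξ‖² = τn₁ from the sector weights.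
  have h11 : nsq ((1 - P₀) *ᵥ ((1 - Q₀) *ᵥ ξ)) = n * (1 + σ * τ) + (1 - τ) * n₁ + (1 - σ) * n₂ := by
    have e1 := h.p₀.nsq_eq_add ((1 - Q₀) *ᵥ ξ)
    have e2 := h.q₀.nsq_eq_add ξ
    have e3 := h.q₀.nsq_eq_add (P₀ *ᵥ ξ)
    rw [← cmp h.c₀₀, ← cmp (cp h.c₀₀)] at e3
    rw [h00] at e3
    linarith
  have hb := weighted_angle_bound hc0 hc1 hσ0 hσ1 hτ0 hτ1 (nsq_nonneg _) (nsq_nonneg _)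
    (nsq_nonneg _) a₁ b₁
  rw [vectorValue, ← Matrix.mulVec_mulVec, ← Matrix.mulVec_mulVec, h00, h11, htot]
  refine ⟨hb.1, fun he => ?_⟩
  rcases hb.2 he with h1 | h1
  · exact absurd (nsq_eq_zero.1 (htot.trans h1)) h0
  · exact Or.inr h1

omit [DecidableEq ι] in
theorem IsStarProjection.isHermitian_sq_sub (h₀ : IsStarProjection P₀)
    (h₁ : IsStarProjection P₁) : ((P₀ - P₁) * (P₀ - P₁)).IsHermitian := by
  have e₀ : P₀ᴴ = P₀ := h₀.isSelfAdjoint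
  have e₁ : P₁ᴴ = P₁ := h₁.isSelfAdjoint
  rw [Matrix.IsHermitian, Matrix.conjTranspose_mul, Matrix.conjTranspose_sub, e₀, e₁]

/-- The tilted Hardy bound for vectors, and the angles of the vectors that attain it. -/
theorem CommutingProjections.vectorValue_le (h : CommutingProjections P₀ P₁ Q₀ Q₁)
    {ξ : ι → ℂ} (hξ : HardyVector P₀ P₁ Q₀ Q₁ ξ) {c : ℝ} (hc0 : 0 < c) (hc1 : c < 1) :
    vectorValue (tiltOf c) P₀ Q₀ ξ ≤ valueOf c * nsq ξ ∧
    (vectorValue (tiltOf c) P₀ Q₀ ξ = valueOf c * nsq ξ →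
      ((P₀ - P₁) * (P₀ - P₁)) *ᵥ ξ = (c : ℂ) • ξ ∧
      ((Q₀ - Q₁) * (Q₀ - Q₁)) *ᵥ ξ = (c : ℂ) • ξ) := by
  obtain ⟨S, E, hE, hTE, hcE, hSE, -⟩ := (h.p₀.isHermitian_sq_sub h.p₁).exists_spectralProjections
  obtain ⟨S', E', hE', hUE', hcE', hSE', -⟩ :=
    (h.q₀.isHermitian_sq_sub h.q₁).exists_spectralProjections
  set T := (P₀ - P₁) * (P₀ - P₁) with hT
  set U := (Q₀ - Q₁) * (Q₀ - Q₁) with hU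
  obtain ⟨cP₀, cP₁⟩ := commute_sq_sub h.p₁.isIdempotentElem.eq h.p₀.isIdempotentElem.eq
  obtain ⟨cQ₀, cQ₁⟩ := commute_sq_sub h.q₁.isIdempotentElem.eq h.q₀.isIdempotentElem.eq
  have hUT : Commute U T := by
    have a : Commute Q₀ T := h.c₀₀.symm.sq_sub h.c₁₀.symm
    have b : Commute Q₁ T := h.c₀₁.symm.sq_sub h.c₁₁.symm
    exact (a.sub_left b).mul_left (a.sub_left b)
  have hEE' : ∀ μ ν, Commute (E μ) (E' ν) := fun μ ν =>
    hcE' _ (hcE _ hUT μ).symm ν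
  -- The joint spectral projections commute with all four projections, so components inherit the
  -- zero constraints, and both value and norm are additive over them.
  let G : ℝ × ℝ → Matrix ι ι ℂ := fun k => E k.1 * E' k.2
  have hGP : ∀ k, IsStarProjection (G k) := by
    intro k
    refine ⟨?_, ?_⟩
    · exact (hE k.1).isIdempotentElem.mul_of_commute (hEE' _ _) (hE' k.2).isIdempotentElem
    · exact ((hE k.1).isSelfAdjoint.commute_iff (hE' k.2).isSelfAdjoint).1 (hEE' _ _)
  have hGS : ∑ k ∈ S ×ˢ S', G k = 1 := by
    rw [Finset.sum_product]
    simp only [G, ← Finset.mul_sum, hSE', mul_one, hSE]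
  have g₁ : ∀ k, Commute P₀ (G k) := fun k => (hcE _ cP₀ _).mul_right
    (hcE' _ (h.c₀₀.sq_sub h.c₀₁) _)
  have g₂ : ∀ k, Commute P₁ (G k) := fun k => (hcE _ cP₁ _).mul_right
    (hcE' _ (h.c₁₀.sq_sub h.c₁₁) _)
  have g₃ : ∀ k, Commute Q₀ (G k) := fun k => (hcE _ (h.c₀₀.symm.sq_sub h.c₁₀.symm) _).mul_right
    (hcE' _ cQ₀ _)
  have g₄ : ∀ k, Commute Q₁ (G k) := fun k => (hcE _ (h.c₀₁.symm.sq_sub h.c₁₁.symm) _).mul_right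
    (hcE' _ cQ₁ _)
  have cp : ∀ {M N : Matrix ι ι ℂ}, Commute M N → Commute (1 - M) N := fun hMN =>
    (Commute.one_left _).sub_left hMN
  have cmp : ∀ {M N : Matrix ι ι ℂ}, Commute M N → ∀ v, M *ᵥ (N *ᵥ v) = N *ᵥ (M *ᵥ v) := by
    intro M N hMN v
    rw [Matrix.mulVec_mulVec, hMN.eq, ← Matrix.mulVec_mulVec]
  have hz : ∀ k, HardyVector P₀ P₁ Q₀ Q₁ (G k *ᵥ ξ) := by
    obtain ⟨z₁, z₂, z₃⟩ := hξ
    intro k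
    refine ⟨?_, ?_, ?_⟩
    · rw [cmp ((g₁ k).mul_left (cp (g₄ k))), z₁, Matrix.mulVec_zero]
    · rw [cmp ((cp (g₂ k)).mul_left (g₃ k)), z₂, Matrix.mulVec_zero]
    · rw [cmp ((g₂ k).mul_left (g₄ k)), z₃, Matrix.mulVec_zero]
  have hTG : ∀ k, T *ᵥ (G k *ᵥ ξ) = (k.1 : ℂ) • (G k *ᵥ ξ) := by
    intro k
    rw [Matrix.mulVec_mulVec, ← mul_assoc, hTE, Matrix.smul_mul, Matrix.smul_mulVec]
  have hUG : ∀ k, U *ᵥ (G k *ᵥ ξ) = (k.2 : ℂ) • (G k *ᵥ ξ) := by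
    intro k
    have : G k = E' k.2 * E k.1 := (hEE' _ _).eq
    rw [this, Matrix.mulVec_mulVec, ← mul_assoc, hUE', Matrix.smul_mul, Matrix.smul_mulVec]
  have hb := fun k => h.sector_bound (hz k) hc0 hc1 (hTG k) (hUG k)
  have hsum : vectorValue (tiltOf c) P₀ Q₀ ξ =
      ∑ k ∈ S ×ˢ S', vectorValue (tiltOf c) P₀ Q₀ (G k *ᵥ ξ) := by
    simp only [vectorValue]
    rw [Finset.sum_add_distrib, ← Finset.mul_sum, ← sum_nsq_mulVec _ G hGP hGS,
      ← sum_nsq_mulVec _ G hGP hGS (((1 - P₀) * (1 - Q₀)) *ᵥ ξ)]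
    simp only [cmp ((g₁ _).mul_left (g₃ _)), cmp ((cp (g₁ _)).mul_left (cp (g₃ _)))]
  have hsum' : valueOf c * nsq ξ = ∑ k ∈ S ×ˢ S', valueOf c * nsq (G k *ᵥ ξ) := by
    rw [← Finset.mul_sum, sum_nsq_mulVec _ G hGP hGS]
  have hle : ∀ k ∈ S ×ˢ S', vectorValue (tiltOf c) P₀ Q₀ (G k *ᵥ ξ) ≤
      valueOf c * nsq (G k *ᵥ ξ) := fun k _ => (hb k).1
  refine ⟨by rw [hsum, hsum']; exact Finset.sum_le_sum hle, fun heq => ?_⟩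
  -- Equality of the sums forces equality in every sector, so only the sector σ = τ = c can carry
  -- weight.
  rw [hsum, hsum', Finset.sum_eq_sum_iff_of_le hle] at heq
  have hξs : ξ = ∑ k ∈ S ×ˢ S', G k *ᵥ ξ := by
    rw [← Matrix.sum_mulVec, hGS, Matrix.one_mulVec]
  constructor
  · rw [hξs, Matrix.mulVec_sum, Finset.smul_sum]
    refine Finset.sum_congr rfl fun k hk => ?_
    rw [hTG]
    rcases (hb k).2 (heq k hk) with h0 | h0
    · simp [h0]
    · rw [h0.1]
  · rw [hξs, Matrix.mulVec_sum, Finset.smul_sum]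
    refine Finset.sum_congr rfl fun k hk => ?_
    rw [hUG]
    rcases (hb k).2 (heq k hk) with h0 | h0
    · simp [h0]
    · rw [h0.2]

end Sector

/-! ### Observables and their projections. -/

section Observables

variable {ι : Type*} [Fintype ι] [DecidableEq ι]

theorem IsBinaryObservable.isStarProjection {M : Matrix ι ι ℂ} (hM : IsBinaryObservable M) :
    IsStarProjection (outcomeProj M 0) := by
  have h0 : outcomeProj M 0 = (1 / 2 : ℂ) • (1 + M) := by simp [outcomeProj]
  rw [h0]
  constructor
  · rw [IsIdempotentElem, Matrix.smul_mul, Matrix.mul_smul, mul_add, add_mul, add_mul, hM.2,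
      one_mul, one_mul, mul_one, smul_smul, add_comm M 1, ← two_smul ℂ, smul_smul]
    norm_num
  · rw [IsSelfAdjoint, Matrix.star_eq_conjTranspose, Matrix.conjTranspose_smul,
      Matrix.conjTranspose_add, Matrix.conjTranspose_one, hM.1.eq]
    simp

omit [Fintype ι] in
theorem outcomeProj_one (M : Matrix ι ι ℂ) : outcomeProj M 1 = 1 - outcomeProj M 0 := by
  ext i j
  simp [outcomeProj]
  ring

omit [Fintype ι] in
theorem eq_two_smul_outcomeProj_sub_one (M : Matrix ι ι ℂ) :
    M = (2 : ℂ) • outcomeProj M 0 - 1 := by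
  ext i j
  simp [outcomeProj]

end Observables

/-! ### The standard qubit model and the extraction of a qubit. -/

/-- The projections of the qubit strategy with `sin² = c`, in the eigenbasis of the second
observable. -/
noncomputable def stdProj (c : ℝ) : Fin 2 → Matrix (Fin 2) (Fin 2) ℂ :=
  ![!![((1 - c : ℝ) : ℂ), ((√c * √(1 - c) : ℝ) : ℂ); ((√c * √(1 - c) : ℝ) : ℂ), (c : ℂ)],
    !![1, 0; 0, 0]]

/-- The observables of the qubit strategy with `sin² = c`, in the eigenbasis of the second
observable. -/
noncomputable def stdObs (c : ℝ) (x : Fin 2) : Matrix (Fin 2) (Fin 2) ℂ :=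
  (2 : ℂ) • stdProj c x - 1

/-- The optimal state for the observables `stdObs c`. -/
noncomputable def stdState (c : ℝ) : Fin 2 × Fin 2 → ℂ := fun p =>
  ((!![0, -(√c / √(1 + c)); -(√c / √(1 + c)), √(1 - c) / √(1 + c)] p.1 p.2 : ℝ) : ℂ)

section OneParty

variable {α : Type*} [Fintype α] [DecidableEq α]

/-- The components of the local isometry that extracts a qubit. -/
theorem exists_swap_components {P : Fin 2 → Matrix α α ℂ} (hP : ∀ x, IsStarProjection (P x))
    {c : ℝ} (hc0 : 0 < c) (hc1 : c < 1) :
    ∃ (E : Matrix α α ℂ) (F : Fin 2 → Matrix α α ℂ),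
      (∃ G, 1 - E = G * ((P 0 - P 1) * (P 0 - P 1) - (c : ℂ) • 1)) ∧
      (F 0)ᴴ * F 0 + (F 1)ᴴ * F 1 = 1 ∧
      F 0 * E = P 1 * E ∧
      F 1 * E = ((√c * √(1 - c) : ℝ) : ℂ)⁻¹ • (P 1 * P 0 * (1 - P 1)) * E ∧
      ∀ x k, F k * P x * E = ∑ k', stdProj c x k k' • (F k' * E) := by
  have h0 := (hP 0).isIdempotentElem.eq
  have h1 := (hP 1).isIdempotentElem.eq
  have s0 : (P 0)ᴴ = P 0 := (hP 0).isSelfAdjoint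
  have s1 : (P 1)ᴴ = P 1 := (hP 1).isSelfAdjoint
  obtain ⟨-, E', hE', hTE', hcE', -, hG⟩ := ((hP 0).isHermitian_sq_sub (hP 1)).exists_spectralProjections
  obtain ⟨c0, c1⟩ := commute_sq_sub h1 h0
  set T := (P 0 - P 1) * (P 0 - P 1) with hT
  set E := E' c
  have hE : E * E = E := (hE' c).isIdempotentElem.eq
  have sE : Eᴴ = E := (hE' c).isSelfAdjoint
  have hTE : T * E = (c : ℂ) • E := hTE' c
  have e0 : P 0 * E = E * P 0 := hcE' _ c0 c
  have e1 : P 1 * E = E * P 1 := hcE' _ c1 c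
  set r : ℂ := ((√c * √(1 - c) : ℝ) : ℂ) with hr
  have hrr : r * r = c * (1 - c) := by
    rw [hr, ← Complex.ofReal_mul]
    have : √c * √(1 - c) * (√c * √(1 - c)) = c * (1 - c) := by
      rw [mul_mul_mul_comm, Real.mul_self_sqrt hc0.le, Real.mul_self_sqrt (by linarith)]
    rw [this]
    push_cast
    rfl
  have hr0 : r ≠ 0 := by
    intro h
    rw [h, mul_zero] at hrr
    have : (c * (1 - c) : ℝ) = 0 := by exact_mod_cast hrr.symm
    nlinarith
  have x1 : P 1 * P 0 * P 1 * E = (1 - c : ℂ) • (P 1 * E) := by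
    rw [sq_sub_conj h1 h0, ← hT, mul_assoc, sub_mul, hTE, one_mul, mul_sub, Matrix.mul_smul,
      sub_smul, one_smul]
  have x0 : P 0 * P 1 * P 0 * E = (1 - c : ℂ) • (P 0 * E) := by
    have hT' : (P 1 - P 0) * (P 1 - P 0) = T := by rw [← neg_sub, neg_mul_neg]
    rw [sq_sub_conj h0 h1, hT', mul_assoc, sub_mul, hTE, one_mul, mul_sub, Matrix.mul_smul,
      sub_smul, one_smul]
  have x2 : (1 - P 1) * P 0 * (1 - P 1) * E = (c : ℂ) • ((1 - P 1) * E) := by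
    rw [sq_sub_conj_compl h1 h0, ← hT, mul_assoc, hTE, Matrix.mul_smul]
  -- On the range of E, r⁻¹P₁P₀(1−P₁) maps the range of 1−P₁ isometrically into that of P₁, so both
  -- qubit levels share one residual space. The summand 1−E only serves to make the whole map an
  -- isometry.
  let F : Fin 2 → Matrix α α ℂ :=
    ![P 1 * E + (1 - E), r⁻¹ • (P 1 * P 0 * (1 - P 1)) * E]
  have F0 : F 0 * E = P 1 * E := by
    simp only [F, Matrix.cons_val_zero, add_mul, sub_mul, mul_assoc, hE, one_mul, sub_self,
      add_zero]
  have F1' : F 1 = r⁻¹ • (P 1 * P 0 * (1 - P 1)) * E := rfl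
  have F1 : F 1 * E = r⁻¹ • (P 1 * P 0 * (1 - P 1)) * E := by
    rw [F1', mul_assoc, hE]
  refine ⟨E, F, hG c, ?_, F0, F1, ?_⟩
  · have a : (F 0)ᴴ * F 0 = P 1 * E + (1 - E) := by
      have z : E * (1 - E) = 0 := by rw [mul_sub, mul_one, hE, sub_self]
      have z' : (1 - E) * E = 0 := by rw [sub_mul, one_mul, hE, sub_self]
      have y : (1 - E) * (1 - E) = 1 - E := by rw [mul_sub, z', mul_one, sub_zero]
      simp only [F, Matrix.cons_val_zero, Matrix.conjTranspose_add, Matrix.conjTranspose_sub,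
        Matrix.conjTranspose_mul, Matrix.conjTranspose_one, sE, s1]
      have : E * P 1 * (P 1 * E) = P 1 * E := by
        rw [← e1, mul_assoc, ← mul_assoc E, ← e1, ← mul_assoc, ← mul_assoc, h1, mul_assoc, hE]
      rw [add_mul, mul_add, mul_add, this, y, ← e1, mul_assoc, z, mul_zero, e1, ← mul_assoc, z',
        zero_mul, add_zero, zero_add]
    have b : (F 1)ᴴ * F 1 = (1 - P 1) * E := by
      have hb1 : (1 - P 1)ᴴ = 1 - P 1 := by
        rw [Matrix.conjTranspose_sub, Matrix.conjTranspose_one, s1]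
      have hrs : star r⁻¹ = r⁻¹ := by
        rw [hr, star_inv₀, RCLike.star_def, Complex.conj_ofReal]
      have hEc : E * (1 - P 1) = (1 - P 1) * E := by rw [mul_sub, sub_mul, ← e1, mul_one, one_mul]
      rw [F1', Matrix.conjTranspose_mul, Matrix.conjTranspose_smul, Matrix.conjTranspose_mul,
        Matrix.conjTranspose_mul, hb1, s0, s1, sE, hrs]
      calc _ = (r⁻¹ * r⁻¹) • (E * ((1 - P 1) * (P 0 * (P 1 * P 1) * P 0 * ((1 - P 1) * E)))) := by
            simp only [Matrix.smul_mul, Matrix.mul_smul, smul_smul, mul_assoc]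
        _ = (r⁻¹ * r⁻¹) • (E * ((1 - P 1) * ((P 0 * P 1 * P 0 * E) * (1 - P 1)))) := by
            rw [h1, ← hEc]
            simp only [mul_assoc]
        _ = (r⁻¹ * r⁻¹ * (1 - c)) • (E * ((1 - P 1) * P 0 * (1 - P 1) * E)) := by
            rw [x0, mul_assoc _ (1 - P 1) E, ← hEc]
            simp only [Matrix.smul_mul, Matrix.mul_smul, smul_smul, mul_assoc]
        _ = (r⁻¹ * r⁻¹ * (c * (1 - c))) • ((1 - P 1) * E) := by
            rw [x2, Matrix.mul_smul, ← mul_assoc, hEc, mul_assoc (1 - P 1), hE, smul_smul]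
            congr 1
            ring
        _ = (1 - P 1) * E := by
            rw [← hrr]
            have : r⁻¹ * r⁻¹ * (r * r) = 1 := by field_simp
            rw [this, one_smul]
    rw [a, b, sub_mul, one_mul]
    abel
  · have p1 : ∀ k, F k * P 1 * E = F k * E * P 1 := fun k => by rw [mul_assoc, e1, mul_assoc]
    have p0 : ∀ k, F k * P 0 * E = F k * E * P 0 := fun k => by rw [mul_assoc, e0, mul_assoc]
    have x3 : P 1 * E * P 1 = P 1 * E := by rw [mul_assoc, ← e1, ← mul_assoc, h1]
    have hcr : r⁻¹ * c * (1 - c) = r := by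
      rw [mul_assoc, ← hrr, ← mul_assoc, inv_mul_cancel₀ hr0, one_mul]
    have pe : P 1 * E * P 0 = P 1 * P 0 * E := by rw [mul_assoc, ← e0, mul_assoc]
    have y2 : P 1 * P 0 * (1 - P 1) * E = P 1 * P 0 * E - (1 - c : ℂ) • (P 1 * E) := by
      rw [← x1, mul_sub, sub_mul, mul_one]
    intro x k
    fin_cases x <;> fin_cases k <;>
      simp only [Fin.zero_eta, Fin.mk_one, Fin.isValue, Fin.sum_univ_two, stdProj,
        Matrix.cons_val_zero, Matrix.cons_val_one, Matrix.of_apply, Matrix.cons_val', one_smul,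
        zero_smul, add_zero, p0, p1, F0, F1, ← hr]
    · rw [pe, Matrix.smul_mul, smul_smul, mul_inv_cancel₀ hr0, one_smul, y2]
      push_cast
      abel
    · have y1 : P 1 * P 0 * (1 - P 1) * P 0 * E = (c : ℂ) • (P 1 * P 0 * E) := by
        have : P 1 * P 0 * (1 - P 1) * P 0 * E =
            P 1 * (P 0 * P 0) * E - P 1 * (P 0 * P 1 * P 0 * E) := by
          simp only [mul_sub, sub_mul, mul_one, mul_assoc]
        rw [this, h0, x0, Matrix.mul_smul, sub_smul, one_smul, ← mul_assoc]
        abel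
      rw [mul_assoc, ← e0, ← mul_assoc, Matrix.smul_mul, Matrix.smul_mul, y1, Matrix.smul_mul, y2,
        smul_sub, smul_sub, smul_smul, smul_smul, smul_smul, smul_smul,
        show (c : ℂ) * r⁻¹ * (1 - c) = r by rw [mul_comm (c : ℂ), hcr],
        mul_comm r⁻¹ (c : ℂ)]
      abel
    · exact x3
    · rw [Matrix.smul_mul, Matrix.smul_mul, mul_assoc, mul_assoc (P 1 * P 0), ← e1,
        ← mul_assoc (1 - P 1), sub_mul, one_mul, h1, sub_self]
      simp

end OneParty

/-! ### Relations between the amplitudes of the extracted state. -/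

section Amplitudes

variable {ι : Type*} [Fintype ι] [DecidableEq ι] {P₀ P₁ Q₀ Q₁ : Matrix ι ι ℂ}

/-- The amplitude of the outcome `(0, ·)` in terms of that of `(1, ·)`. -/
theorem CommutingProjections.amplitude (h : CommutingProjections P₀ P₁ Q₀ Q₁) {ξ : ι → ℂ}
    (hξ : HardyVector P₀ P₁ Q₀ Q₁ ξ) {c : ℝ}
    (hT : ((P₀ - P₁) * (P₀ - P₁)) *ᵥ ξ = (c : ℂ) • ξ) :
    (1 - c : ℂ) • ((P₁ * (Q₁ * Q₀ * (1 - Q₁))) *ᵥ ξ) =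
      -((P₁ * P₀ * (1 - P₁) * (Q₁ * Q₀ * (1 - Q₁))) *ᵥ ξ) := by
  obtain ⟨i₁, i₂, i₃⟩ := hξ.identities
  -- The third identity is multiplied by P₁, and P₁P₀P₁ξ = (1−c)P₁ξ.
  have a : (1 - c : ℂ) • (P₁ *ᵥ ξ) = -((P₁ * P₀ * (1 - P₁) * (1 - Q₁)) *ᵥ ξ) := by
    have e1 : (P₁ * P₀ * P₁) *ᵥ ξ = (1 - c : ℂ) • (P₁ *ᵥ ξ) := by
      rw [sq_sub_conj h.p₁.isIdempotentElem.eq h.p₀.isIdempotentElem.eq, ← Matrix.mulVec_mulVec,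
        Matrix.sub_mulVec, hT, Matrix.one_mulVec, Matrix.mulVec_sub, Matrix.mulVec_smul, sub_smul,
        one_smul]
    have e2 := congrArg (fun v => P₁ *ᵥ v) i₃
    simp only [Matrix.mulVec_mulVec, Matrix.mulVec_neg, ← mul_assoc] at e2
    rw [e2, neg_neg, e1]
  have hq : (1 - Q₁) * (1 - Q₁) = 1 - Q₁ := h.q₁.one_sub.isIdempotentElem.eq
  have cp : ∀ {M N : Matrix ι ι ℂ}, Commute M N → Commute M (1 - N) := fun hMN =>
    (Commute.one_right _).sub_right hMN
  have c1 : Commute P₁ (Q₁ * Q₀ * (1 - Q₁)) := (h.c₁₁.mul_right h.c₁₀).mul_right (cp h.c₁₁)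
  have c0 : Commute P₀ (Q₁ * Q₀ * (1 - Q₁)) := (h.c₀₁.mul_right h.c₀₀).mul_right (cp h.c₀₁)
  have c2 : Commute (P₁ * P₀ * (1 - P₁)) (Q₁ * Q₀ * (1 - Q₁)) :=
    (c1.mul_left c0).mul_left (cp c1.symm).symm
  -- This factor commutes with the first party's operators and absorbs 1−Q₁ on its right.
  have a' := congrArg (fun v => (Q₁ * Q₀ * (1 - Q₁)) *ᵥ v) a
  simp only [Matrix.mulVec_smul, Matrix.mulVec_neg, Matrix.mulVec_mulVec] at a'
  rw [c1.eq, a', ← mul_assoc, ← c2.eq, mul_assoc, mul_assoc (Q₁ * Q₀), hq]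

end Amplitudes

/-- The qubit state `φ` with the observables `A`, `B` is a local change of basis of the standard
optimal strategy with `sin² = c`. -/
structure IsStdModel (c : ℝ) (φ : Fin 2 × Fin 2 → ℂ) (A B : Fin 2 → Matrix (Fin 2) (Fin 2) ℂ)
    (R R' : Matrix (Fin 2) (Fin 2) ℂ) : Prop where
  conjTranspose_mul_left : Rᴴ * R = 1
  conjTranspose_mul_right : R'ᴴ * R' = 1
  obs_left : ∀ x, A x = R * stdObs c x * Rᴴ
  obs_right : ∀ y, B y = R' * stdObs c y * R'ᴴ
  state : φ = (R ⊗ₖ R') *ᵥ stdState c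

/-! ### Tensor products and the matrix of the isometry. -/

section Kronecker

variable {α β : Type*} [Fintype α] [Fintype β] [DecidableEq α] [DecidableEq β]

omit [DecidableEq α] in
theorem IsStarProjection.kronecker_one {P : Matrix α α ℂ} (hP : IsStarProjection P) :
    IsStarProjection (P ⊗ₖ (1 : Matrix β β ℂ)) := by
  have h : Pᴴ = P := hP.isSelfAdjoint
  refine ⟨?_, ?_⟩
  · rw [IsIdempotentElem, ← Matrix.mul_kronecker_mul, hP.isIdempotentElem.eq, one_mul]
  · rw [IsSelfAdjoint, Matrix.star_eq_conjTranspose, Matrix.conjTranspose_kronecker, h,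
      Matrix.conjTranspose_one]

omit [DecidableEq β] in
theorem IsStarProjection.one_kronecker {P : Matrix β β ℂ} (hP : IsStarProjection P) :
    IsStarProjection ((1 : Matrix α α ℂ) ⊗ₖ P) := by
  have h : Pᴴ = P := hP.isSelfAdjoint
  refine ⟨?_, ?_⟩
  · rw [IsIdempotentElem, ← Matrix.mul_kronecker_mul, hP.isIdempotentElem.eq, one_mul]
  · rw [IsSelfAdjoint, Matrix.star_eq_conjTranspose, Matrix.conjTranspose_kronecker, h,
      Matrix.conjTranspose_one]

theorem kronecker_one_mul_one_kronecker (M : Matrix α α ℂ) (N : Matrix β β ℂ) :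
    (M ⊗ₖ (1 : Matrix β β ℂ)) * ((1 : Matrix α α ℂ) ⊗ₖ N) = M ⊗ₖ N := by
  rw [← Matrix.mul_kronecker_mul, mul_one, one_mul]

theorem commute_kronecker_one (M : Matrix α α ℂ) (N : Matrix β β ℂ) :
    Commute (M ⊗ₖ (1 : Matrix β β ℂ)) ((1 : Matrix α α ℂ) ⊗ₖ N) := by
  rw [Commute, SemiconjBy, ← Matrix.mul_kronecker_mul, ← Matrix.mul_kronecker_mul]
  simp only [mul_one, one_mul]

omit [Fintype α] [Fintype β] [DecidableEq α] in
theorem sub_kronecker_one (M N : Matrix α α ℂ) :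
    (M - N) ⊗ₖ (1 : Matrix β β ℂ) = M ⊗ₖ (1 : Matrix β β ℂ) - N ⊗ₖ (1 : Matrix β β ℂ) := by
  ext i j
  simp [sub_mul]

omit [Fintype α] [Fintype β] [DecidableEq β] in
theorem one_kronecker_sub (M N : Matrix β β ℂ) :
    (1 : Matrix α α ℂ) ⊗ₖ (M - N) = (1 : Matrix α α ℂ) ⊗ₖ M - (1 : Matrix α α ℂ) ⊗ₖ N := by
  ext i j
  simp [mul_sub]

theorem commutingProjections_kronecker {P : Fin 2 → Matrix α α ℂ} {Q : Fin 2 → Matrix β β ℂ}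
    (hP : ∀ x, IsStarProjection (P x)) (hQ : ∀ y, IsStarProjection (Q y)) :
    CommutingProjections (P 0 ⊗ₖ (1 : Matrix β β ℂ)) (P 1 ⊗ₖ (1 : Matrix β β ℂ))
      ((1 : Matrix α α ℂ) ⊗ₖ Q 0) ((1 : Matrix α α ℂ) ⊗ₖ Q 1) :=
  ⟨(hP 0).kronecker_one, (hP 1).kronecker_one, (hQ 0).one_kronecker, (hQ 1).one_kronecker,
    commute_kronecker_one _ _, commute_kronecker_one _ _, commute_kronecker_one _ _,
    commute_kronecker_one _ _⟩

omit [DecidableEq α] [DecidableEq β] in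
theorem kronecker_mulVec_apply {α' β' : Type*} (V : Matrix α' α ℂ) (W : Matrix β' β ℂ)
    (ζ : α × β → ℂ) (a : α') (b : β') :
    ((V ⊗ₖ W) *ᵥ ζ) (a, b) = ∑ i, ∑ j, V a i * W b j * ζ (i, j) := by
  rw [Matrix.mulVec, dotProduct, Fintype.sum_prod_type]
  rfl

/-- The isometry with the components `F`, in the basis given by the columns of `R`. -/
def swapMatrix (R : Matrix (Fin 2) (Fin 2) ℂ) (F : Fin 2 → Matrix α α ℂ) :
    Matrix (α × Fin 2) α ℂ :=
  Matrix.of fun p j => ∑ k, R p.2 k * F k p.1 j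

theorem swapMatrix_isometry {R : Matrix (Fin 2) (Fin 2) ℂ} (hR : Rᴴ * R = 1)
    {F : Fin 2 → Matrix α α ℂ} (hF : (F 0)ᴴ * F 0 + (F 1)ᴴ * F 1 = 1) :
    (swapMatrix R F)ᴴ * swapMatrix R F = 1 := by
  rw [← hF]
  ext i j
  have h00 := congrFun (congrFun hR 0) 0
  have h01 := congrFun (congrFun hR 0) 1
  have h10 := congrFun (congrFun hR 1) 0
  have h11 := congrFun (congrFun hR 1) 1
  simp [Matrix.mul_apply, Fin.sum_univ_two] at h00 h01 h10 h11
  simp only [Matrix.mul_apply, Matrix.conjTranspose_apply, Matrix.add_apply, swapMatrix,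
    Matrix.of_apply, Fintype.sum_prod_type, Fin.sum_univ_two, ← Finset.sum_add_distrib, star_add,
    star_mul', RCLike.star_def]
  refine Finset.sum_congr rfl fun k _ => ?_
  linear_combination (starRingEnd ℂ) (F 0 k i) * F 0 k j * h00 +
    (starRingEnd ℂ) (F 0 k i) * F 1 k j * h01 + (starRingEnd ℂ) (F 1 k i) * F 0 k j * h10 +
    (starRingEnd ℂ) (F 1 k i) * F 1 k j * h11

omit [DecidableEq α] [DecidableEq β] in
theorem swapMatrix_kronecker_mulVec (R R' : Matrix (Fin 2) (Fin 2) ℂ)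
    (F : Fin 2 → Matrix α α ℂ) (F' : Fin 2 → Matrix β β ℂ) (ζ : α × β → ℂ)
    (i : α) (j : β) (k l : Fin 2) :
    ((swapMatrix R F ⊗ₖ swapMatrix R' F') *ᵥ ζ) ((i, k), (j, l)) =
      ∑ k', ∑ l', R k k' * R' l l' * ((F k' ⊗ₖ F' l') *ᵥ ζ) (i, j) := by
  simp only [kronecker_mulVec_apply, swapMatrix, Matrix.of_apply, Fin.sum_univ_two,
    Finset.mul_sum, ← Finset.sum_add_distrib]
  refine Finset.sum_congr rfl fun _ _ => Finset.sum_congr rfl fun _ _ => ?_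
  ring

end Kronecker

/-! ### Extraction of the optimal qubit strategy. -/

section Forward

variable {α β : Type*} [Fintype α] [Fintype β] [DecidableEq α] [DecidableEq β]

/-- The relation is linear in the operator, so it passes from the projections to the observables. -/
theorem withId_intertwine {P : Fin 2 → Matrix α α ℂ} {A : Fin 2 → Matrix α α ℂ}
    (hA : ∀ x, A x = (2 : ℂ) • P x - 1) {c : ℝ} {E : Matrix α α ℂ} {F : Fin 2 → Matrix α α ℂ}
    (hF : ∀ x k, F k * P x * E = ∑ k', stdProj c x k k' • (F k' * E)) (x : Option (Fin 2))
    (k : Fin 2) :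
    F k * withId A x * E = ∑ k', withId (stdObs c) x k k' • (F k' * E) := by
  cases x with
  | none => fin_cases k <;> simp [withId, Matrix.one_apply]
  | some x =>
    simp only [withId, hA, stdObs, mul_sub, sub_mul, Matrix.mul_smul, Matrix.smul_mul, hF,
      mul_one]
    fin_cases k <;> simp [Fin.sum_univ_two, sub_smul, mul_smul, smul_add]

theorem withId_conj {A : Fin 2 → Matrix (Fin 2) (Fin 2) ℂ} {R : Matrix (Fin 2) (Fin 2) ℂ} {c : ℝ}
    (hR : Rᴴ * R = 1) (hA : ∀ x, A x = R * stdObs c x * Rᴴ) (x : Option (Fin 2)) :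
    withId A x * R = R * withId (stdObs c) x := by
  cases x with
  | none => simp [withId]
  | some x => simp only [withId]; rw [hA, mul_assoc, hR, mul_one]

/-- Vectors with the optimal angles and the Hardy zeros contain the optimal qubit strategy. -/
theorem exists_swap_isometries {P : Fin 2 → Matrix α α ℂ} {Q : Fin 2 → Matrix β β ℂ}
    (hP : ∀ x, IsStarProjection (P x)) (hQ : ∀ y, IsStarProjection (Q y))
    {A : Fin 2 → Matrix α α ℂ} {B : Fin 2 → Matrix β β ℂ}
    (hA : ∀ x, A x = (2 : ℂ) • P x - 1) (hB : ∀ y, B y = (2 : ℂ) • Q y - 1)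
    {c : ℝ} (hc0 : 0 < c) (hc1 : c < 1) {φ : Fin 2 × Fin 2 → ℂ}
    {R R' : Matrix (Fin 2) (Fin 2) ℂ} {A' B' : Fin 2 → Matrix (Fin 2) (Fin 2) ℂ}
    (hm : IsStdModel c φ A' B' R R') :
    ∃ (VA : Matrix (α × Fin 2) α ℂ) (VB : Matrix (β × Fin 2) β ℂ),
    VAᴴ * VA = 1 ∧ VBᴴ * VB = 1 ∧
      ∀ ξ : α × β → ℂ, HardyVector (P 0 ⊗ₖ (1 : Matrix β β ℂ)) (P 1 ⊗ₖ (1 : Matrix β β ℂ))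
        ((1 : Matrix α α ℂ) ⊗ₖ Q 0) ((1 : Matrix α α ℂ) ⊗ₖ Q 1) ξ →
        ((P 0 ⊗ₖ (1 : Matrix β β ℂ) - P 1 ⊗ₖ (1 : Matrix β β ℂ)) *
          (P 0 ⊗ₖ (1 : Matrix β β ℂ) - P 1 ⊗ₖ (1 : Matrix β β ℂ))) *ᵥ ξ = (c : ℂ) • ξ →
        (((1 : Matrix α α ℂ) ⊗ₖ Q 0 - (1 : Matrix α α ℂ) ⊗ₖ Q 1) *
          ((1 : Matrix α α ℂ) ⊗ₖ Q 0 - (1 : Matrix α α ℂ) ⊗ₖ Q 1)) *ᵥ ξ = (c : ℂ) • ξ →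
        ∃ χ : α × β → ℂ, ∀ x y : Option (Fin 2), ∀ (i : α) (j : β) (k l : Fin 2),
          ((VA ⊗ₖ VB) *ᵥ ((withId A x ⊗ₖ withId B y) *ᵥ ξ)) ((i, k), (j, l)) =
            χ (i, j) * ((withId A' x ⊗ₖ withId B' y) *ᵥ φ) (k, l) := by
  obtain ⟨E, F, ⟨G, hG⟩, hF, hF0, hF1, hFP⟩ := exists_swap_components hP hc0 hc1
  obtain ⟨E', F', ⟨G', hG'⟩, hF', hF0', hF1', hFQ⟩ := exists_swap_components hQ hc0 hc1
  refine ⟨swapMatrix R F, swapMatrix R' F', swapMatrix_isometry hm.conjTranspose_mul_left hF,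
    swapMatrix_isometry hm.conjTranspose_mul_right hF', fun ξ hξ hT hU => ?_⟩
  have hcomm := commutingProjections_kronecker hP hQ
  -- The factorization of 1−E through (P₀−P₁)² − c is tensored with the identity and applied to the
  -- eigenvector ξ.
  have hEξ : (E ⊗ₖ (1 : Matrix β β ℂ)) *ᵥ ξ = ξ := by
    have h1 : ((1 - E) ⊗ₖ (1 : Matrix β β ℂ)) *ᵥ ξ = 0 := by
      have : (G ⊗ₖ (1 : Matrix β β ℂ)) * ((P 0 ⊗ₖ (1 : Matrix β β ℂ) - P 1 ⊗ₖ (1 : Matrix β β ℂ)) *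
          (P 0 ⊗ₖ (1 : Matrix β β ℂ) - P 1 ⊗ₖ (1 : Matrix β β ℂ)) - (c : ℂ) • 1) =
          (1 - E) ⊗ₖ (1 : Matrix β β ℂ) := by
        rw [hG, ← sub_kronecker_one, ← Matrix.mul_kronecker_mul, one_mul,
          ← Matrix.one_kronecker_one, ← Matrix.smul_kronecker, ← sub_kronecker_one,
          ← Matrix.mul_kronecker_mul, one_mul]
      rw [← this, ← Matrix.mulVec_mulVec, Matrix.sub_mulVec, hT, Matrix.smul_mulVec,
        Matrix.one_mulVec, sub_self, Matrix.mulVec_zero]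
    rw [sub_kronecker_one, Matrix.one_kronecker_one, Matrix.sub_mulVec, Matrix.one_mulVec,
      sub_eq_zero] at h1
    exact h1.symm
  have hEξ' : ((1 : Matrix α α ℂ) ⊗ₖ E') *ᵥ ξ = ξ := by
    have h1 : ((1 : Matrix α α ℂ) ⊗ₖ (1 - E')) *ᵥ ξ = 0 := by
      have : ((1 : Matrix α α ℂ) ⊗ₖ G') * (((1 : Matrix α α ℂ) ⊗ₖ Q 0 - (1 : Matrix α α ℂ) ⊗ₖ Q 1) *
          ((1 : Matrix α α ℂ) ⊗ₖ Q 0 - (1 : Matrix α α ℂ) ⊗ₖ Q 1) - (c : ℂ) • 1) =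
          (1 : Matrix α α ℂ) ⊗ₖ (1 - E') := by
        rw [hG', ← one_kronecker_sub, ← Matrix.mul_kronecker_mul, one_mul,
          ← Matrix.one_kronecker_one, ← Matrix.kronecker_smul, ← one_kronecker_sub,
          ← Matrix.mul_kronecker_mul, one_mul]
      rw [← this, ← Matrix.mulVec_mulVec, Matrix.sub_mulVec, hU, Matrix.smul_mulVec,
        Matrix.one_mulVec, sub_self, Matrix.mulVec_zero]
    rw [one_kronecker_sub, Matrix.one_kronecker_one, Matrix.sub_mulVec, Matrix.one_mulVec,
      sub_eq_zero] at h1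
    exact h1.symm
  have hEE : (E ⊗ₖ E') *ᵥ ξ = ξ := by
    rw [← kronecker_one_mul_one_kronecker, ← Matrix.mulVec_mulVec, hEξ', hEξ]
  set r : ℂ := ((√c * √(1 - c) : ℝ) : ℂ) with hr
  set S := P 1 * P 0 * (1 - P 1) with hS
  set S' := Q 1 * Q 0 * (1 - Q 1) with hS'
  have hFF : ∀ (M : Matrix α α ℂ) (N : Matrix β β ℂ), (M ⊗ₖ N) *ᵥ ξ = ((M * E) ⊗ₖ (N * E')) *ᵥ ξ := by
    intro M N
    conv_lhs => rw [← hEE]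
    rw [Matrix.mulVec_mulVec, Matrix.mul_kronecker_mul]
  have a00 : (F 0 ⊗ₖ F' 0) *ᵥ ξ = 0 := by
    rw [hFF, hF0, hF0', ← hFF, ← kronecker_one_mul_one_kronecker]
    exact hξ.2.2
  have a01 : (F 0 ⊗ₖ F' 1) *ᵥ ξ = r⁻¹ • ((P 1 ⊗ₖ S') *ᵥ ξ) := by
    rw [hFF, hF0, hF1', ← hFF, Matrix.kronecker_smul, Matrix.smul_mulVec]
  have a10 : (F 1 ⊗ₖ F' 0) *ᵥ ξ = r⁻¹ • ((S ⊗ₖ Q 1) *ᵥ ξ) := by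
    rw [hFF, hF1, hF0', ← hFF, Matrix.smul_kronecker, Matrix.smul_mulVec]
  have a11 : (F 1 ⊗ₖ F' 1) *ᵥ ξ = (r⁻¹ * r⁻¹) • ((S ⊗ₖ S') *ᵥ ξ) := by
    rw [hFF, hF1, hF1', ← hFF, Matrix.smul_kronecker, Matrix.kronecker_smul, smul_smul,
      Matrix.smul_mulVec]
  have b01 : (1 - c : ℂ) • ((P 1 ⊗ₖ S') *ᵥ ξ) = -((S ⊗ₖ S') *ᵥ ξ) := by
    have h := hcomm.amplitude hξ hT
    rw [← Matrix.one_kronecker_one, ← sub_kronecker_one, ← one_kronecker_sub] at h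
    simp only [← Matrix.mul_kronecker_mul, one_mul, mul_one] at h
    simpa only [hS, hS', mul_assoc] using h
  have b10 : (1 - c : ℂ) • ((S ⊗ₖ Q 1) *ᵥ ξ) = -((S ⊗ₖ S') *ᵥ ξ) := by
    have h := hcomm.symm.amplitude (hcomm.hardyVector_symm hξ) hU
    rw [← Matrix.one_kronecker_one, ← sub_kronecker_one, ← one_kronecker_sub] at h
    simp only [← Matrix.mul_kronecker_mul, one_mul, mul_one] at h
    simpa only [hS, hS', mul_assoc] using h
  have hd0 : (1 - c : ℂ) ≠ 0 := by
    have : (1 - c : ℝ) ≠ 0 := by linarith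
    exact_mod_cast this
  have e1 : (√(1 - c) : ℂ) ≠ 0 := by exact_mod_cast (Real.sqrt_pos.2 (by linarith)).ne'
  have e2 : (√(1 + c) : ℂ) ≠ 0 := by exact_mod_cast (Real.sqrt_pos.2 (by linarith)).ne'
  have e3 : (√c : ℂ) ≠ 0 := by exact_mod_cast (Real.sqrt_pos.2 hc0).ne'
  have e4 : (√(1 - c) : ℂ) * √(1 - c) = 1 - c := by
    rw [← Complex.ofReal_mul, Real.mul_self_sqrt (by linarith)]
    push_cast
    rfl
  have b01' : (P 1 ⊗ₖ S') *ᵥ ξ = (-(1 - c : ℂ)⁻¹) • ((S ⊗ₖ S') *ᵥ ξ) := by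
    rw [neg_smul, ← smul_neg, ← b01, smul_smul, inv_mul_cancel₀ hd0, one_smul]
  have b10' : (S ⊗ₖ Q 1) *ᵥ ξ = (-(1 - c : ℂ)⁻¹) • ((S ⊗ₖ S') *ᵥ ξ) := by
    rw [neg_smul, ← smul_neg, ← b10, smul_smul, inv_mul_cancel₀ hd0, one_smul]
  -- The residual vector is the (1,1) component divided by the amplitude of `stdState c` there; the
  -- amplitude relations make all other components multiples of it.
  let κ : α × β → ℂ := ((√(1 + c) / √(1 - c) : ℝ) : ℂ) • ((F 1 ⊗ₖ F' 1) *ᵥ ξ)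
  have hamp : ∀ k l i j, ((F k ⊗ₖ F' l) *ᵥ ξ) (i, j) = κ (i, j) * stdState c (k, l) := by
    have h01 : r⁻¹ * -(1 - c : ℂ)⁻¹ = (√(1 + c) / √(1 - c)) * (r⁻¹ * r⁻¹) * -(√c / √(1 + c)) := by
      rw [← e4, hr]
      push_cast
      field_simp
    intro k l i j
    fin_cases k <;> fin_cases l <;>
      simp only [Fin.zero_eta, Fin.mk_one, Fin.isValue, stdState, κ, Pi.smul_apply,
        Matrix.cons_val_zero, Matrix.cons_val_one, Matrix.of_apply, Matrix.cons_val']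
    · simp [a00]
    · rw [a01, b01', a11, smul_smul, h01]
      simp only [Pi.smul_apply, smul_eq_mul]
      push_cast
      ring
    · rw [a10, b10', a11, smul_smul, h01]
      simp only [Pi.smul_apply, smul_eq_mul]
      push_cast
      ring
    · simp only [smul_eq_mul]
      push_cast
      field_simp
  refine ⟨κ, fun x y i j k l => ?_⟩
  -- The observables are moved through the isometry to the qubits, so the same κ serves all pairs of
  -- settings.
  have hstep : ∀ k l, ((F k ⊗ₖ F' l) *ᵥ ((withId A x ⊗ₖ withId B y) *ᵥ ξ)) (i, j) =
      κ (i, j) * ((withId (stdObs c) x ⊗ₖ withId (stdObs c) y) *ᵥ stdState c) (k, l) := by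
    intro k l
    rw [Matrix.mulVec_mulVec, ← Matrix.mul_kronecker_mul, hFF, withId_intertwine hA hFP,
      withId_intertwine hB hFQ, kronecker_mulVec_apply (withId (stdObs c) x)]
    have : (∑ k', withId (stdObs c) x k k' • (F k' * E)) ⊗ₖ
        (∑ l', withId (stdObs c) y l l' • (F' l' * E')) =
        ∑ k', ∑ l', (withId (stdObs c) x k k' * withId (stdObs c) y l l') •
          ((F k' * E) ⊗ₖ (F' l' * E')) := by
      ext p q
      simp only [Fin.sum_univ_two, Matrix.kroneckerMap_apply, Matrix.add_apply, Matrix.smul_apply,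
        smul_eq_mul]
      ring
    rw [this]
    simp only [Matrix.sum_mulVec, Matrix.smul_mulVec, ← hFF, Finset.sum_apply, Pi.smul_apply, hamp,
      smul_eq_mul, Finset.mul_sum]
    refine Finset.sum_congr rfl fun _ _ => Finset.sum_congr rfl fun _ _ => ?_
    ring
  rw [swapMatrix_kronecker_mulVec]
  simp only [hstep]
  rw [hm.state, Matrix.mulVec_mulVec, ← Matrix.mul_kronecker_mul,
    withId_conj hm.conjTranspose_mul_left hm.obs_left,
    withId_conj hm.conjTranspose_mul_right hm.obs_right, Matrix.mul_kronecker_mul,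
    ← Matrix.mulVec_mulVec, kronecker_mulVec_apply R R']
  simp only [Finset.mul_sum]
  refine Finset.sum_congr rfl fun _ _ => Finset.sum_congr rfl fun _ _ => ?_
  ring

end Forward

/-! ### From vectors to mixed strategies. -/

section Strategy

theorem nsq_isometry_mulVec {m n : Type*} [Fintype m] [Fintype n] [DecidableEq n]
    {V : Matrix m n ℂ} (hV : Vᴴ * V = 1) (v : n → ℂ) : nsq (V *ᵥ v) = nsq v := by
  rw [nsq_eq_re, nsq_eq_re, Matrix.star_mulVec, ← Matrix.dotProduct_mulVec, Matrix.mulVec_mulVec,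
    hV, Matrix.one_mulVec]

theorem IsBinaryObservable.isStarProjection_outcomeProj {ι : Type*} [Fintype ι] [DecidableEq ι]
    {M : Matrix ι ι ℂ} (hM : IsBinaryObservable M) (a : Fin 2) :
    IsStarProjection (outcomeProj M a) := by
  fin_cases a
  · exact hM.isStarProjection
  · simp only [Fin.mk_one, outcomeProj_one]
    exact hM.isStarProjection.one_sub

theorem IsStarProjection.kronecker {α β : Type*} [Fintype α] [Fintype β] {P : Matrix α α ℂ}
    {Q : Matrix β β ℂ} (hP : IsStarProjection P) (hQ : IsStarProjection Q) :
    IsStarProjection (P ⊗ₖ Q) := by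
  have h : Pᴴ = P := hP.isSelfAdjoint
  have h' : Qᴴ = Q := hQ.isSelfAdjoint
  refine ⟨?_, ?_⟩
  · rw [IsIdempotentElem, ← Matrix.mul_kronecker_mul, hP.isIdempotentElem.eq,
      hQ.isIdempotentElem.eq]
  · rw [IsSelfAdjoint, Matrix.star_eq_conjTranspose, Matrix.conjTranspose_kronecker, h, h']

variable {α β : Type*} [Fintype α] [Fintype β] [DecidableEq α] [DecidableEq β]
  (s : QuantumStrategy α β)

/-- With ρ = Σ |Kᵢ⟩⟨Kᵢ| every probability is a sum of squared norms, so a vanishing one annihilates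
each column separately. -/
theorem QuantumStrategy.behavior_eq_sum {K : Matrix (α × β) (α × β) ℂ} (hK : s.ρ = K * Kᴴ)
    (a b x y : Fin 2) : s.behavior a b x y =
      ∑ i, nsq ((outcomeProj (s.A x) a ⊗ₖ outcomeProj (s.B y) b) *ᵥ K.col i) := by
  rw [QuantumStrategy.behavior, hK, trace_mul_mul_conjTranspose, Complex.re_sum]
  refine Finset.sum_congr rfl fun i _ => ?_
  rw [(((s.observable_A x).isStarProjection_outcomeProj a).kronecker
    ((s.observable_B y).isStarProjection_outcomeProj b)).nsq_mulVec]

theorem QuantumStrategy.sum_nsq_col {K : Matrix (α × β) (α × β) ℂ} (hK : s.ρ = K * Kᴴ) :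
    ∑ i, nsq (K.col i) = 1 := by
  have h := trace_mul_mul_conjTranspose 1 K
  rw [← hK, one_mul, s.trace_eq_one] at h
  have h' := congrArg Complex.re h
  simp only [Matrix.one_mulVec, Complex.re_sum, ← nsq_eq_re, Complex.one_re] at h'
  exact h'.symm

/-- The projections of the two parties, lifted to the joint space, commute. -/
theorem QuantumStrategy.commutingProjections :
    CommutingProjections (outcomeProj (s.A 0) 0 ⊗ₖ (1 : Matrix β β ℂ))
      (outcomeProj (s.A 1) 0 ⊗ₖ (1 : Matrix β β ℂ))
      ((1 : Matrix α α ℂ) ⊗ₖ outcomeProj (s.B 0) 0)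
      ((1 : Matrix α α ℂ) ⊗ₖ outcomeProj (s.B 1) 0) :=
  commutingProjections_kronecker (P := fun x => outcomeProj (s.A x) 0)
    (Q := fun y => outcomeProj (s.B y) 0) (fun x => (s.observable_A x).isStarProjection)
    (fun y => (s.observable_B y).isStarProjection)

theorem QuantumStrategy.hardyVector_col {K : Matrix (α × β) (α × β) ℂ} (hK : s.ρ = K * Kᴴ)
    (hz : HardyZero s.behavior) (i : α × β) :
    HardyVector (outcomeProj (s.A 0) 0 ⊗ₖ (1 : Matrix β β ℂ))
      (outcomeProj (s.A 1) 0 ⊗ₖ (1 : Matrix β β ℂ))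
      ((1 : Matrix α α ℂ) ⊗ₖ outcomeProj (s.B 0) 0)
      ((1 : Matrix α α ℂ) ⊗ₖ outcomeProj (s.B 1) 0) (K.col i) := by
  have zero : ∀ a b x y, s.behavior a b x y = 0 →
      (outcomeProj (s.A x) a ⊗ₖ outcomeProj (s.B y) b) *ᵥ K.col i = 0 := by
    intro a b x y h
    rw [s.behavior_eq_sum hK, Finset.sum_eq_zero_iff_of_nonneg fun _ _ => nsq_nonneg _] at h
    exact nsq_eq_zero.1 (h i (Finset.mem_univ i))
  obtain ⟨z₁, z₂, z₃⟩ := hz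
  refine ⟨?_, ?_, ?_⟩
  · rw [← Matrix.one_kronecker_one, ← one_kronecker_sub, kronecker_one_mul_one_kronecker,
      ← outcomeProj_one]
    exact zero _ _ _ _ z₁
  · rw [← Matrix.one_kronecker_one, ← sub_kronecker_one, kronecker_one_mul_one_kronecker,
      ← outcomeProj_one]
    exact zero _ _ _ _ z₂
  · rw [kronecker_one_mul_one_kronecker]
    exact zero _ _ _ _ z₃

theorem QuantumStrategy.hardyValue_eq_sum {K : Matrix (α × β) (α × β) ℂ} (hK : s.ρ = K * Kᴴ)
    (w : ℝ) : hardyValue w s.behavior =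
      ∑ i, vectorValue w (outcomeProj (s.A 0) 0 ⊗ₖ (1 : Matrix β β ℂ))
        ((1 : Matrix α α ℂ) ⊗ₖ outcomeProj (s.B 0) 0) (K.col i) := by
  simp only [hardyValue, s.behavior_eq_sum hK, vectorValue, Finset.mul_sum,
    ← Finset.sum_add_distrib, outcomeProj_one, kronecker_one_mul_one_kronecker]
  rw [← Matrix.one_kronecker_one, ← one_kronecker_sub, ← sub_kronecker_one,
    kronecker_one_mul_one_kronecker]

theorem QuantumStrategy.hardyValue_le {c : ℝ} (hc0 : 0 < c) (hc1 : c < 1)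
    (hz : HardyZero s.behavior) : hardyValue (tiltOf c) s.behavior ≤ valueOf c := by
  obtain ⟨K, -, hK, -⟩ := s.posSemidef.exists_factorization
  rw [s.hardyValue_eq_sum hK, ← mul_one (valueOf c), ← s.sum_nsq_col hK, Finset.mul_sum]
  exact Finset.sum_le_sum fun i _ =>
    (s.commutingProjections.vectorValue_le (s.hardyVector_col hK hz i) hc0 hc1).1

theorem QuantumStrategy.isLocallyEquivalentTo_of_hardyValue_eq {c : ℝ} (hc0 : 0 < c) (hc1 : c < 1)
    (hz : HardyZero s.behavior) (hv : hardyValue (tiltOf c) s.behavior = valueOf c)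
    {φ : Fin 2 × Fin 2 → ℂ} {A B : Fin 2 → Matrix (Fin 2) (Fin 2) ℂ}
    {R R' : Matrix (Fin 2) (Fin 2) ℂ} (hm : IsStdModel c φ A B R R') :
    s.IsLocallyEquivalentTo φ A B := by
  obtain ⟨K, -, hK, -⟩ := s.posSemidef.exists_factorization
  have hz' := fun i => s.hardyVector_col hK hz i
  have hb := fun i => s.commutingProjections.vectorValue_le (hz' i) hc0 hc1
  have heq : ∀ i ∈ Finset.univ, _ := (Finset.sum_eq_sum_iff_of_le fun i _ => (hb i).1).1 (by
    rw [← s.hardyValue_eq_sum hK, hv, ← Finset.mul_sum, s.sum_nsq_col hK, mul_one])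
  obtain ⟨VA, VB, hVA, hVB, h⟩ := exists_swap_isometries (P := fun x => outcomeProj (s.A x) 0)
    (Q := fun y => outcomeProj (s.B y) 0) (fun x => (s.observable_A x).isStarProjection)
    (fun y => (s.observable_B y).isStarProjection)
    (fun x => eq_two_smul_outcomeProj_sub_one (s.A x))
    (fun y => eq_two_smul_outcomeProj_sub_one (s.B y)) hc0 hc1 hm
  refine ⟨VA, VB, hVA, hVB, fun v => h _ ?_ ?_ ?_⟩
  -- Vectors ρv = K(Kᴴv) are combinations of the columns, so linear conditions pass to the whole
  -- range of ρ.
  · have lift : ∀ M : Matrix (α × β) (α × β) ℂ, (∀ i, M *ᵥ K.col i = 0) → M *ᵥ (s.ρ *ᵥ v) = 0 := by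
      intro M hM
      have : M * K = 0 := by
        ext i j
        exact congrFun (hM j) i
      rw [hK, Matrix.mulVec_mulVec, ← mul_assoc, this, zero_mul, Matrix.zero_mulVec]
    exact ⟨lift _ fun i => (hz' i).1, lift _ fun i => (hz' i).2.1, lift _ fun i => (hz' i).2.2⟩
  all_goals
    have lift : ∀ M : Matrix (α × β) (α × β) ℂ, (∀ i, M *ᵥ K.col i = (c : ℂ) • K.col i) →
        M *ᵥ (s.ρ *ᵥ v) = (c : ℂ) • (s.ρ *ᵥ v) := by
      intro M hM
      have : M * K = (c : ℂ) • K := by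
        ext i j
        exact congrFun (hM j) i
      rw [hK, Matrix.mulVec_mulVec, ← mul_assoc, this, Matrix.smul_mul, Matrix.smul_mulVec]
  · exact lift _ fun i => ((hb i).2 (heq i (Finset.mem_univ i))).1
  · exact lift _ fun i => ((hb i).2 (heq i (Finset.mem_univ i))).2

theorem outcomeProj_eq_withId {ι : Type*} [DecidableEq ι] (M : Fin 2 → Matrix ι ι ℂ)
    (a x : Fin 2) : outcomeProj (M x) a =
      (1 / 2 : ℂ) • (withId M none + (-1 : ℂ) ^ (a : ℕ) • withId M (some x)) := rfl

/-- Local equivalence determines the behaviour. -/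
theorem QuantumStrategy.IsLocallyEquivalentTo.behavior_eq {φ : Fin 2 × Fin 2 → ℂ}
    {A B : Fin 2 → Matrix (Fin 2) (Fin 2) ℂ} (h : s.IsLocallyEquivalentTo φ A B)
    (hφ : nsq φ = 1) (a b x y : Fin 2) :
    s.behavior a b x y = nsq ((outcomeProj (A x) a ⊗ₖ outcomeProj (B y) b) *ᵥ φ) := by
  obtain ⟨VA, VB, hVA, hVB, h⟩ := h
  obtain ⟨K, L, hK, hL⟩ := s.posSemidef.exists_factorization
  have hV : (VA ⊗ₖ VB)ᴴ * (VA ⊗ₖ VB) = 1 := by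
    rw [Matrix.conjTranspose_kronecker, ← Matrix.mul_kronecker_mul, hVA, hVB,
      Matrix.one_kronecker_one]
  have hprod : ∀ (ζ : (α × Fin 2) × (β × Fin 2) → ℂ) (χ : α × β → ℂ) (η : Fin 2 × Fin 2 → ℂ),
      (∀ i j k l, ζ ((i, k), (j, l)) = χ (i, j) * η (k, l)) → nsq ζ = nsq χ * nsq η := by
    intro ζ χ η hζ
    simp only [nsq, Fintype.sum_prod_type, hζ, Complex.normSq_mul, Fin.sum_univ_two,
      Finset.sum_mul, ← Finset.sum_add_distrib]
    refine Finset.sum_congr rfl fun i _ => Finset.sum_congr rfl fun j _ => ?_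
    ring
  have hcol : ∀ i, K.col i = s.ρ *ᵥ L.col i := by
    intro i
    rw [hL]
    rfl
  -- The columns of K = ρL lie in the range of ρ, so local equivalence applies to each. Its residual
  -- vector has the norm of the column, hence the squared norms add up to 1.
  choose χ hχ using fun i => h (L.col i)
  have hn : ∀ i, nsq (K.col i) = nsq (χ i) := by
    intro i
    have := hprod _ (χ i) _ (fun i' j k l => hχ i none none i' j k l)
    rw [nsq_isometry_mulVec hV] at this
    simpa [withId, hφ, ← hcol] using this
  have hb : ∀ i, nsq ((outcomeProj (s.A x) a ⊗ₖ outcomeProj (s.B y) b) *ᵥ K.col i) =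
      nsq (χ i) * nsq ((outcomeProj (A x) a ⊗ₖ outcomeProj (B y) b) *ᵥ φ) := by
    intro i
    rw [← nsq_isometry_mulVec hV]
    refine hprod _ (χ i) _ fun i' j k l => ?_
    rw [hcol]
    simp only [outcomeProj_eq_withId, Matrix.smul_kronecker, Matrix.kronecker_smul,
      Matrix.add_kronecker, Matrix.kronecker_add, Matrix.add_mulVec, Matrix.smul_mulVec,
      Matrix.mulVec_add, Matrix.mulVec_smul, Pi.add_apply, Pi.smul_apply, hχ, smul_eq_mul]
    ring
  rw [s.behavior_eq_sum hK]
  simp only [hb]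
  rw [← Finset.sum_mul]
  simp only [← hn]
  rw [s.sum_nsq_col hK, one_mul]

end Strategy

/-! ### The standard model and its self-test. -/

section StdModel

variable {c : ℝ}

theorem outcomeProj_stdObs_zero (c : ℝ) (x : Fin 2) : outcomeProj (stdObs c x) 0 = stdProj c x := by
  ext i j
  simp [outcomeProj, stdObs]

theorem isBinaryObservable_stdObs (hc0 : 0 < c) (hc1 : c < 1) (x : Fin 2) :
    IsBinaryObservable (stdObs c x) := by
  have h1 : (√c : ℂ) * √c = c := by
    rw [← Complex.ofReal_mul, Real.mul_self_sqrt hc0.le]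
  have h2 : (√(1 - c) : ℂ) * √(1 - c) = 1 - c := by
    rw [← Complex.ofReal_mul, Real.mul_self_sqrt (by linarith)]
    push_cast
    rfl
  constructor
  · ext i j
    fin_cases x <;> fin_cases i <;> fin_cases j <;>
      simp [stdObs, stdProj, Matrix.conjTranspose_apply]
  · ext i j
    fin_cases x <;> fin_cases i <;> fin_cases j <;>
      simp [stdObs, stdProj, Matrix.mul_apply, Fin.sum_univ_two] <;>
      first | ring1 | linear_combination (4 * √c * √c : ℂ) * h2 + 4 * (1 - c) * h1

theorem nsq_stdState (hc0 : 0 < c) (hc1 : c < 1) : nsq (stdState c) = 1 := by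
  have h1 : √c * √c = c := Real.mul_self_sqrt hc0.le
  have h2 : √(1 - c) * √(1 - c) = 1 - c := Real.mul_self_sqrt (by linarith)
  have h3 : √(1 + c) * √(1 + c) = 1 + c := Real.mul_self_sqrt (by linarith)
  have h4 : 1 + c ≠ 0 := by linarith
  simp only [nsq, Fintype.sum_prod_type, Fin.sum_univ_two, stdState, Complex.normSq_ofReal]
  simp [div_mul_div_comm, h1, h2, h3]
  field_simp
  ring

theorem nsq_kronecker_mulVec_ofReal {M N : Matrix (Fin 2) (Fin 2) ℂ} {σ : Fin 2 × Fin 2 → ℂ}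
    (m n t : Matrix (Fin 2) (Fin 2) ℝ) (hM : ∀ i j, M i j = m i j) (hN : ∀ i j, N i j = n i j)
    (hσ : ∀ i j, σ (i, j) = t i j) :
    nsq ((M ⊗ₖ N) *ᵥ σ) = ∑ k, ∑ l, (∑ i, ∑ j, m k i * n l j * t i j) ^ 2 := by
  rw [nsq, Fintype.sum_prod_type]
  refine Finset.sum_congr rfl fun k _ => Finset.sum_congr rfl fun l _ => ?_
  have : ((M ⊗ₖ N) *ᵥ σ) (k, l) = ((∑ i, ∑ j, m k i * n l j * t i j : ℝ) : ℂ) := by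
    rw [kronecker_mulVec_apply]
    push_cast
    simp only [hM, hN, hσ]
  rw [this, Complex.normSq_ofReal, sq]

theorem std_hardy (hc0 : 0 < c) (hc1 : c < 1) :
    let p : Behavior := fun a b x y =>
      nsq ((outcomeProj (stdObs c x) a ⊗ₖ outcomeProj (stdObs c y) b) *ᵥ stdState c)
    HardyZero p ∧ hardyValue (tiltOf c) p = valueOf c := by
  have h1 : √c ^ 2 = c := Real.sq_sqrt hc0.le
  have h2 : √(1 - c) ^ 2 = 1 - c := Real.sq_sqrt (by linarith)
  have h3 : √(1 + c) ^ 2 = 1 + c := Real.sq_sqrt (by linarith)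
  have h4 : √(1 + c) ≠ 0 := (Real.sqrt_pos.2 (by linarith)).ne'
  have h5 : 1 + c ≠ 0 := by linarith
  intro p
  let m : Fin 2 → Fin 2 → Matrix (Fin 2) (Fin 2) ℝ := fun x a =>
    ![![!![1 - c, √c * √(1 - c); √c * √(1 - c), c], !![c, -(√c * √(1 - c)); -(√c * √(1 - c)), 1 - c]],
      ![!![1, 0; 0, 0], !![0, 0; 0, 1]]] x a
  have hm : ∀ x a i j, outcomeProj (stdObs c x) a i j = m x a i j := by
    intro x a i j
    fin_cases x <;> fin_cases a <;> fin_cases i <;> fin_cases j <;>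
      simp [m, outcomeProj_one, outcomeProj_stdObs_zero, stdProj]
  have hp : ∀ a b x y, p a b x y = _ := fun a b x y =>
    nsq_kronecker_mulVec_ofReal (m x a) (m y b)
      !![0, -(√c / √(1 + c)); -(√c / √(1 + c)), √(1 - c) / √(1 + c)] (hm x a) (hm y b)
      (fun _ _ => rfl)
  simp only [HardyZero, hardyValue, hp]
  simp [m, Fin.sum_univ_two]
  generalize √c = b at *
  generalize √(1 - c) = a at *
  generalize √(1 + c) = d at *
  subst h1
  have hab : a ^ 2 + b ^ 2 = 1 := by linarith
  rw [← h2]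
  refine ⟨by ring, ?_⟩
  generalize hw : tiltOf (b ^ 2) = w
  -- The factors a²+b² = 1 are inserted so that the left-hand equality holds identically, without
  -- using that relation.
  trans (a ^ 2 + b ^ 2) ^ 2 * (a ^ 2 * b ^ 4 + w * a ^ 2 * (b ^ 2 + (a ^ 2 + b ^ 2)) ^ 2) / d ^ 2
  · field_simp
    ring
  · rw [hab, h2, h3, ← hw, tiltOf, valueOf]
    field_simp
    ring

theorem IsStdModel.outcome {φ : Fin 2 × Fin 2 → ℂ} {A B : Fin 2 → Matrix (Fin 2) (Fin 2) ℂ}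
    {R R' : Matrix (Fin 2) (Fin 2) ℂ} (hm : IsStdModel c φ A B R R') (a b x y : Fin 2) :
    nsq ((outcomeProj (A x) a ⊗ₖ outcomeProj (B y) b) *ᵥ φ) =
      nsq ((outcomeProj (stdObs c x) a ⊗ₖ outcomeProj (stdObs c y) b) *ᵥ stdState c) := by
  have conj : ∀ {R M N : Matrix (Fin 2) (Fin 2) ℂ}, Rᴴ * R = 1 → M = R * N * Rᴴ →
      outcomeProj M a * R = R * outcomeProj N a ∧ outcomeProj M b * R = R * outcomeProj N b := by
    intro R M N hR hM
    have hMR : M * R = R * N := by rw [hM, mul_assoc, hR, mul_one]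
    simp only [outcomeProj, Matrix.smul_mul, Matrix.mul_smul, add_mul, mul_add, hMR, one_mul,
      mul_one, and_self]
  have hRR : (R ⊗ₖ R')ᴴ * (R ⊗ₖ R') = 1 := by
    rw [Matrix.conjTranspose_kronecker, ← Matrix.mul_kronecker_mul, hm.conjTranspose_mul_left,
      hm.conjTranspose_mul_right, Matrix.one_kronecker_one]
  rw [hm.state, Matrix.mulVec_mulVec, ← Matrix.mul_kronecker_mul,
    (conj hm.conjTranspose_mul_left (hm.obs_left x)).1,
    (conj hm.conjTranspose_mul_right (hm.obs_right y)).2, Matrix.mul_kronecker_mul,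
    ← Matrix.mulVec_mulVec, nsq_isometry_mulVec hRR]

theorem IsStdModel.nsq_eq_one {φ : Fin 2 × Fin 2 → ℂ} {A B : Fin 2 → Matrix (Fin 2) (Fin 2) ℂ}
    {R R' : Matrix (Fin 2) (Fin 2) ℂ} (hm : IsStdModel c φ A B R R') (hc0 : 0 < c) (hc1 : c < 1) :
    nsq φ = 1 := by
  have hRR : (R ⊗ₖ R')ᴴ * (R ⊗ₖ R') = 1 := by
    rw [Matrix.conjTranspose_kronecker, ← Matrix.mul_kronecker_mul, hm.conjTranspose_mul_left,
      hm.conjTranspose_mul_right, Matrix.one_kronecker_one]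
  rw [hm.state, nsq_isometry_mulVec hRR, nsq_stdState hc0 hc1]

/-- The self-testing equivalence for any local change of basis of the standard strategy. -/
theorem IsStdModel.selfTest {φ : Fin 2 × Fin 2 → ℂ} {A B : Fin 2 → Matrix (Fin 2) (Fin 2) ℂ}
    {R R' : Matrix (Fin 2) (Fin 2) ℂ} (hm : IsStdModel c φ A B R R') (hc0 : 0 < c) (hc1 : c < 1)
    {α β : Type*} [Fintype α] [Fintype β] [DecidableEq α] [DecidableEq β]
    (s : QuantumStrategy α β) :
    (HardyZero s.behavior ∧ hardyValue (tiltOf c) s.behavior = valueOf c) ↔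
      s.IsLocallyEquivalentTo φ A B := by
  refine ⟨fun h => s.isLocallyEquivalentTo_of_hardyValue_eq hc0 hc1 h.1 h.2 hm, fun h => ?_⟩
  have hb : s.behavior = fun a b x y =>
      nsq ((outcomeProj (stdObs c x) a ⊗ₖ outcomeProj (stdObs c y) b) *ᵥ stdState c) := by
    funext a b x y
    rw [h.behavior_eq s (hm.nsq_eq_one hc0 hc1), hm.outcome]
  rw [hb]
  exact std_hardy hc0 hc1

theorem isBinaryObservable_conj {M R : Matrix (Fin 2) (Fin 2) ℂ} (hR : Rᴴ * R = 1)
    (hM : IsBinaryObservable M) : IsBinaryObservable (R * M * Rᴴ) := by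
  constructor
  · rw [Matrix.IsHermitian, Matrix.conjTranspose_mul, Matrix.conjTranspose_mul,
      Matrix.conjTranspose_conjTranspose, hM.1.eq, mul_assoc]
  · calc R * M * Rᴴ * (R * M * Rᴴ) = R * M * (Rᴴ * R) * M * Rᴴ := by simp only [mul_assoc]
      _ = R * (M * M) * Rᴴ := by rw [hR, mul_one, mul_assoc R]
      _ = 1 := by rw [hM.2, mul_one, mul_eq_one_comm.1 hR]

/-- A local change of basis of the standard strategy, as a strategy. -/
noncomputable def IsStdModel.strategy {φ : Fin 2 × Fin 2 → ℂ}
    {A B : Fin 2 → Matrix (Fin 2) (Fin 2) ℂ} {R R' : Matrix (Fin 2) (Fin 2) ℂ}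
    (hm : IsStdModel c φ A B R R') (hc0 : 0 < c) (hc1 : c < 1) :
    QuantumStrategy (Fin 2) (Fin 2) where
  ρ := pureState φ
  A := A
  B := B
  posSemidef := Matrix.posSemidef_vecMulVec_self_star φ
  trace_eq_one := by
    rw [pureState, Matrix.trace_vecMulVec, dotProduct_comm, star_dotProduct_self,
      hm.nsq_eq_one hc0 hc1, Complex.ofReal_one]
  observable_A x := by
    rw [hm.obs_left x]
    exact isBinaryObservable_conj hm.conjTranspose_mul_left (isBinaryObservable_stdObs hc0 hc1 x)
  observable_B y := by
    rw [hm.obs_right y]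
    exact isBinaryObservable_conj hm.conjTranspose_mul_right (isBinaryObservable_stdObs hc0 hc1 y)

/-- The isometry |j⟩ ↦ |0⟩|j⟩ moves each qubit to the ancilla, and the residual vector is |00⟩
scaled by ⟨φ, v⟩. -/
theorem isLocallyEquivalentTo_self (s : QuantumStrategy (Fin 2) (Fin 2)) {φ : Fin 2 × Fin 2 → ℂ}
    (h : s.ρ = pureState φ) : s.IsLocallyEquivalentTo φ s.A s.B := by
  let V : Matrix (Fin 2 × Fin 2) (Fin 2) ℂ :=
    Matrix.of fun p j => if p.1 = 0 ∧ p.2 = j then 1 else 0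
  have hV : Vᴴ * V = 1 := by
    ext i j
    fin_cases i <;> fin_cases j <;>
      simp [V, Matrix.mul_apply, Fintype.sum_prod_type, Fin.sum_univ_two]
  refine ⟨V, V, hV, hV, fun v => ⟨fun p => if p.1 = 0 ∧ p.2 = 0 then star φ ⬝ᵥ v else 0, ?_⟩⟩
  intro x y i j k l
  have hρ : s.ρ *ᵥ v = (star φ ⬝ᵥ v) • φ := by
    rw [h, pureState, Matrix.vecMulVec_mulVec]
    ext p
    simp [mul_comm]
  rw [hρ, Matrix.mulVec_smul, Matrix.mulVec_smul, Pi.smul_apply, kronecker_mulVec_apply]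
  fin_cases i <;> fin_cases j <;> fin_cases k <;> fin_cases l <;>
    simp [V]

/-- Equivalence with itself and the converse half of the self-test replace a Born-rule computation.
-/
theorem IsStdModel.strategy_hardy {φ : Fin 2 × Fin 2 → ℂ}
    {A B : Fin 2 → Matrix (Fin 2) (Fin 2) ℂ} {R R' : Matrix (Fin 2) (Fin 2) ℂ}
    (hm : IsStdModel c φ A B R R') (hc0 : 0 < c) (hc1 : c < 1) :
    HardyZero (hm.strategy hc0 hc1).behavior ∧
      hardyValue (tiltOf c) (hm.strategy hc0 hc1).behavior = valueOf c :=
  (hm.selfTest hc0 hc1 _).2 (isLocallyEquivalentTo_self _ rfl)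

end StdModel

/-! ### The classical bound. -/

section Local

theorem LHVModel.integrable_mul {Ω : Type*} [MeasurableSpace Ω] (m : LHVModel Ω)
    (a b x y : Fin 2) : Integrable (fun l => m.pA a x l * m.pB b y l) m.μ := by
  have := m.isProb
  have hA : ∀ l, m.pA a x l ≤ 1 := fun l => by
    rw [← m.pA_sum x l]
    exact Finset.single_le_sum (fun i _ => m.pA_nonneg i x l) (Finset.mem_univ a)
  have hB : ∀ l, m.pB b y l ≤ 1 := fun l => by
    rw [← m.pB_sum y l]
    exact Finset.single_le_sum (fun i _ => m.pB_nonneg i y l) (Finset.mem_univ b)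
  refine Integrable.of_bound ((m.measurable_pA a x).mul (m.measurable_pB b y)).aestronglyMeasurable
    1 (Filter.Eventually.of_forall fun l => ?_)
  rw [Real.norm_of_nonneg (mul_nonneg (m.pA_nonneg a x l) (m.pB_nonneg b y l))]
  exact mul_le_one₀ (hA l) (m.pB_nonneg b y l) (hB l)

theorem LHVModel.behavior_mem_Icc {Ω : Type*} [MeasurableSpace Ω] (m : LHVModel Ω)
    (a b x y : Fin 2) : 0 ≤ m.behavior a b x y ∧ m.behavior a b x y ≤ 1 := by
  have := m.isProb
  refine ⟨integral_nonneg fun l => mul_nonneg (m.pA_nonneg a x l) (m.pB_nonneg b y l), ?_⟩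
  have h : m.behavior a b x y ≤ ∫ _, (1 : ℝ) ∂m.μ := by
    refine integral_mono (m.integrable_mul a b x y) (integrable_const _) fun l => ?_
    refine mul_le_one₀ ?_ (m.pB_nonneg b y l) ?_
    · rw [← m.pA_sum x l]
      exact Finset.single_le_sum (fun i _ => m.pA_nonneg i x l) (Finset.mem_univ a)
    · rw [← m.pB_sum y l]
      exact Finset.single_le_sum (fun i _ => m.pB_nonneg i y l) (Finset.mem_univ b)
  simpa using h

/-- Hardy's argument at almost every hidden value: if both parties could answer 0 at setting 0, the
first two constraints would force 0 at setting 1 on both sides, against the third. Hence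
P(0,0|A₀,B₀) = 0. -/
theorem LHVModel.hardyValue_le {Ω : Type*} [MeasurableSpace Ω] (m : LHVModel Ω) (w : ℝ)
    (hz : HardyZero m.behavior) : hardyValue w m.behavior ≤ max 0 w := by
  have zero : ∀ a b x y, m.behavior a b x y = 0 →
      ∀ᵐ l ∂m.μ, m.pA a x l * m.pB b y l = 0 := by
    intro a b x y h
    exact (integral_eq_zero_iff_of_nonneg
      (fun l => mul_nonneg (m.pA_nonneg a x l) (m.pB_nonneg b y l))
      (m.integrable_mul a b x y)).1 h
  obtain ⟨z₁, z₂, z₃⟩ := hz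
  have h0 : m.behavior 0 0 0 0 = 0 := by
    refine integral_eq_zero_of_ae ?_
    filter_upwards [zero _ _ _ _ z₁, zero _ _ _ _ z₂, zero _ _ _ _ z₃] with l h₁ h₂ h₃
    by_contra h
    obtain ⟨ha, hb⟩ := mul_ne_zero_iff.1 h
    have hA := m.pA_sum 1 l
    have hB := m.pB_sum 1 l
    rw [Fin.sum_univ_two] at hA hB
    have e₁ : m.pB 1 1 l = 0 := (mul_eq_zero.1 h₁).resolve_left ha
    have e₂ : m.pA 1 1 l = 0 := (mul_eq_zero.1 h₂).resolve_right hb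
    rw [e₁, add_zero] at hB
    rw [e₂, add_zero] at hA
    rw [hA, hB] at h₃
    norm_num at h₃
  obtain ⟨p0, p1⟩ := m.behavior_mem_Icc 1 1 0 0
  rw [hardyValue, h0, zero_add]
  rcases le_total w 0 with hw | hw
  · exact le_max_of_le_left (mul_nonpos_of_nonpos_of_nonneg hw p0)
  · exact le_max_of_le_right (by nlinarith)

/-- The deterministic local model with the outputs `f x` and `g y`. -/
noncomputable def deterministicModel (f g : Fin 2 → Fin 2) : LHVModel Unit where
  μ := Measure.dirac ()
  isProb := inferInstance
  pA a x _ := if a = f x then 1 else 0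
  pB b y _ := if b = g y then 1 else 0
  measurable_pA _ _ := measurable_const
  measurable_pB _ _ := measurable_const
  pA_nonneg a x _ := by split_ifs <;> norm_num
  pB_nonneg b y _ := by split_ifs <;> norm_num
  pA_sum x _ := by simp
  pB_sum y _ := by simp

theorem deterministicModel_behavior (f g : Fin 2 → Fin 2) (a b x y : Fin 2) :
    (deterministicModel f g).behavior a b x y =
      (if a = f x then 1 else 0) * (if b = g y then 1 else 0) := by
  simp [LHVModel.behavior, deterministicModel]

theorem exists_lhvModel_hardyValue_eq (w : ℝ) :
    ∃ m : LHVModel Unit, HardyZero m.behavior ∧ hardyValue w m.behavior = max 0 w := by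
  rcases le_total w 0 with hw | hw
  -- One party outputs its setting and the other the opposite of its own, giving value 0; for w ≥ 0
  -- the constant output 1 gives w.
  · refine ⟨deterministicModel ![0, 1] ![1, 0], ?_, ?_⟩ <;>
      simp [HardyZero, hardyValue, deterministicModel_behavior, hw]
  · refine ⟨deterministicModel ![1, 1] ![1, 1], ?_, ?_⟩ <;>
      simp [HardyZero, hardyValue, deterministicModel_behavior, hw]

end Local

/-! ### From w and θ to c, and the explicit strategy. -/

section Parameters

variable {c : ℝ}

/-- In terms of c the radicand is a perfect square, so the quantum value and sin θ become rational
in c. -/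
theorem sqrt_tiltOf (hc0 : 0 < c) : √(4 * tiltOf c + 5) = (3 + c) / (1 + c) := by
  have h : 1 + c ≠ 0 := by positivity
  rw [show 4 * tiltOf c + 5 = ((3 + c) / (1 + c)) ^ 2 by unfold tiltOf; field_simp; ring]
  exact Real.sqrt_sq (by positivity)

theorem hardyQuantumValue_tiltOf (hc0 : 0 < c) : hardyQuantumValue (tiltOf c) = valueOf c := by
  have h : 1 + c ≠ 0 := by positivity
  have h2 : tiltOf c + 1 = (2 + c) / (1 + c) ^ 2 := by unfold tiltOf; field_simp; ring
  have h3 : 2 + c ≠ 0 := by positivity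
  rw [hardyQuantumValue, sqrt_tiltOf hc0, h2]
  unfold tiltOf valueOf
  field_simp
  ring

theorem tiltOf_mem (hc0 : 0 < c) (hc1 : c < 1) : tiltOf c ∈ Set.Ioo (-1 / 4 : ℝ) 1 := by
  have h : 0 < (1 + c) ^ 2 := by positivity
  unfold tiltOf
  constructor
  · rw [lt_div_iff₀ h]
    nlinarith
  · rw [div_lt_iff₀ h]
    nlinarith

theorem exists_tiltOf_eq {w : ℝ} (hw : w ∈ Set.Ioo (-1 / 4 : ℝ) 1) :
    ∃ c, 0 < c ∧ c < 1 ∧ tiltOf c = w := by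
  obtain ⟨h1, h2⟩ := hw
  have hr : √(4 * w + 5) ^ 2 = 4 * w + 5 := Real.sq_sqrt (by linarith)
  have hr0 := Real.sqrt_nonneg (4 * w + 5)
  set r := √(4 * w + 5)
  have r2 : 2 < r := by nlinarith
  have r3 : r < 3 := by nlinarith
  have e : r - 1 ≠ 0 := by linarith
  -- The solution of r = (3+c)/(1+c) for c.
  refine ⟨(3 - r) / (r - 1), div_pos (by linarith) (by linarith), ?_, ?_⟩
  · rw [div_lt_one (by linarith)]
    linarith
  · have e1 : 1 + (3 - r) / (r - 1) = 2 / (r - 1) := by field_simp; ring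
    rw [tiltOf, e1]
    have : w = (r ^ 2 - 5) / 4 := by linarith
    rw [this]
    field_simp
    ring

theorem sin_hardyAngle (hc0 : 0 < c) (hc1 : c < 1) :
    Real.sin (hardyAngle (tiltOf c)) = 2 * c / (1 + c) := by
  have h : 0 < 1 + c := by positivity
  have e : 3 - (3 + c) / (1 + c) = 2 * c / (1 + c) := by field_simp; ring
  rw [hardyAngle, sqrt_tiltOf hc0, e, Real.sin_arcsin]
  · have : 0 ≤ 2 * c / (1 + c) := by positivity
    linarith
  · rw [div_le_one h]
    linarith

theorem max_lt_valueOf (hc0 : 0 < c) (hc1 : c < 1) : max 0 (tiltOf c) < valueOf c :=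
  max_lt (valueOf_pos hc0 hc1) (tiltOf_lt_valueOf hc0)

/-- The cosine and sine of half the optimal angle. -/
theorem half_hardyAngle (hc0 : 0 < c) (hc1 : c < 1) :
    Real.cos (hardyAngle (tiltOf c) / 2) = (√(1 + 3 * c) + √(1 - c)) / (2 * √(1 + c)) ∧
      Real.sin (hardyAngle (tiltOf c) / 2) = (√(1 + 3 * c) - √(1 - c)) / (2 * √(1 + c)) := by
  have hs := sin_hardyAngle hc0 hc1
  -- With θ in [0, π/2] all signs are known, so every trigonometric value may be compared after
  -- squaring.
  have hlo : 0 ≤ hardyAngle (tiltOf c) := by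
    by_contra! h
    have h1 : Real.sin (hardyAngle (tiltOf c)) < 0 :=
      Real.sin_neg_of_neg_of_neg_pi_lt h (by
        have := Real.neg_pi_div_two_le_arcsin (3 - √(4 * tiltOf c + 5))
        unfold hardyAngle
        linarith [Real.pi_pos])
    rw [hs] at h1
    have : 0 < 2 * c / (1 + c) := by positivity
    linarith
  have hhi : hardyAngle (tiltOf c) ≤ Real.pi / 2 := Real.arcsin_le_pi_div_two _
  set θ := hardyAngle (tiltOf c)
  have ha : √(1 - c) ^ 2 = 1 - c := Real.sq_sqrt (by linarith)
  have hd : √(1 + c) ^ 2 = 1 + c := Real.sq_sqrt (by linarith)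
  have he : √(1 + 3 * c) ^ 2 = 1 + 3 * c := Real.sq_sqrt (by linarith)
  have hd0 : 0 < √(1 + c) := Real.sqrt_pos.2 (by linarith)
  have hae : √(1 - c) ≤ √(1 + 3 * c) := Real.sqrt_le_sqrt (by linarith)
  have ha0 := Real.sqrt_nonneg (1 - c)
  have he0 := Real.sqrt_nonneg (1 + 3 * c)
  have hcos0 : 0 ≤ Real.cos θ := Real.cos_nonneg_of_mem_Icc ⟨by linarith [Real.pi_pos], hhi⟩
  have hcos : Real.cos θ = √(1 - c) * √(1 + 3 * c) / (1 + c) := by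
    have hp : 0 ≤ √(1 - c) * √(1 + 3 * c) / (1 + c) := by positivity
    refine (sq_eq_sq₀ hcos0 hp).1 ?_
    rw [Real.cos_sq', hs, div_pow, div_pow, mul_pow, mul_pow, ha, he]
    field_simp
    ring
  have hc2 : 0 ≤ Real.cos (θ / 2) :=
    Real.cos_nonneg_of_mem_Icc ⟨by linarith [Real.pi_pos], by linarith [Real.pi_pos]⟩
  have hs2 : 0 ≤ Real.sin (θ / 2) :=
    Real.sin_nonneg_of_nonneg_of_le_pi (by linarith) (by linarith [Real.pi_pos])
  have hsq : Real.cos (θ / 2) ^ 2 = 1 / 2 + Real.cos θ / 2 := by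
    rw [Real.cos_sq, mul_div_cancel₀ θ two_ne_zero]
  constructor
  · refine (sq_eq_sq₀ hc2 (by positivity)).1 ?_
    rw [hsq, hcos, div_pow, mul_pow, hd, add_sq, ha, he]
    field_simp
    ring
  · refine (sq_eq_sq₀ hs2 (div_nonneg (by linarith) (by positivity))).1 ?_
    rw [Real.sin_sq, hsq, hcos, div_pow, mul_pow, hd, sub_sq, ha, he]
    field_simp
    ring

/-- The coefficients of the optimal observables. -/
theorem hardyObs_tiltOf (hc0 : 0 < c) (hc1 : c < 1) :
    hardyObs (hardyAngle (tiltOf c)) =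
      ![((-(1 + 2 * c) * (√(1 - c) / √(1 + 3 * c)) : ℝ) : ℂ) • pauliZ +
          ((-c * (2 * (√c / √(1 + 3 * c))) : ℝ) : ℂ) • pauliX,
        ((-(√(1 - c) / √(1 + 3 * c)) : ℝ) : ℂ) • pauliZ +
          ((2 * (√c / √(1 + 3 * c)) : ℝ) : ℂ) • pauliX] := by
  have h : 0 < 1 + c := by linarith
  have hd0 : 0 < √(1 + c) := Real.sqrt_pos.2 h
  have he0 : 0 < √(1 + 3 * c) := Real.sqrt_pos.2 (by linarith)
  have e1 : √(1 - 2 * c / (1 + c)) = √(1 - c) / √(1 + c) := by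
    rw [← Real.sqrt_div' _ h.le]; congr 1; field_simp; ring
  have e2 : √(1 + 2 * c / (1 + c)) = √(1 + 3 * c) / √(1 + c) := by
    rw [← Real.sqrt_div' _ h.le]; congr 1; field_simp; ring
  have e3 : √2 * √(2 * c / (1 + c)) = 2 * √c / √(1 + c) := by
    rw [Real.sqrt_div' _ h.le, Real.sqrt_mul (by norm_num), ← mul_div_assoc, ← mul_assoc,
      Real.mul_self_sqrt (by norm_num)]
  have e4 : √2 * (2 * c / (1 + c)) * √(2 * c / (1 + c)) =
      2 * c / (1 + c) * (2 * √c / √(1 + c)) := by rw [← e3]; ring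
  have e5 : 2 - 2 * c / (1 + c) = 2 / (1 + c) := by field_simp; ring
  have e6 : 2 + 2 * c / (1 + c) = 2 * (1 + 2 * c) / (1 + c) := by field_simp; ring
  rw [hardyObs, sin_hardyAngle hc0 hc1, e1, e2, e3, e4, e5, e6]
  congr 4 <;> congr 2 <;> field_simp

theorem stdObs_zero (c : ℝ) : stdObs c 0 =
    !![1 - 2 * (c : ℂ), 2 * ((√c : ℂ) * √(1 - c)); 2 * ((√c : ℂ) * √(1 - c)), 2 * c - 1] := by
  ext i j
  fin_cases i <;> fin_cases j <;> simp [stdObs, stdProj]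
  ring

theorem stdObs_one (c : ℝ) : stdObs c 1 = !![1, 0; 0, -1] := by
  ext i j
  fin_cases i <;> fin_cases j <;> simp [stdObs, stdProj]
  norm_num

theorem stdState_apply (c : ℝ) : stdState c (0, 0) = 0 ∧
    stdState c (0, 1) = -(√c / √(1 + c) : ℂ) ∧ stdState c (1, 0) = -(√c / √(1 + c) : ℂ) ∧
    stdState c (1, 1) = (√(1 - c) / √(1 + c) : ℂ) := by
  simp [stdState]

/-- The explicit strategy is a rotation of the standard one. -/
theorem exists_isStdModel_hardy (hc0 : 0 < c) (hc1 : c < 1) :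
    ∃ R, IsStdModel c (hardyState (hardyAngle (tiltOf c))) (hardyObs (hardyAngle (tiltOf c)))
      (hardyObs (hardyAngle (tiltOf c))) R R := by
  have he0 : 0 < √(1 + 3 * c) := Real.sqrt_pos.2 (by linarith)
  have hae : √(1 - c) ≤ √(1 + 3 * c) := Real.sqrt_le_sqrt (by linarith)
  have ha := Real.sq_sqrt (show 0 ≤ 1 - c by linarith)
  have hb := Real.sq_sqrt hc0.le
  have hd : √(1 + c) ≠ 0 := (Real.sqrt_pos.2 (by linarith)).ne'
  have he := Real.sq_sqrt (show 0 ≤ 1 + 3 * c by linarith)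
  obtain ⟨hcos, hsin⟩ := half_hardyAngle hc0 hc1
  have hb0 := Real.sqrt_nonneg c
  have ha0 := Real.sqrt_nonneg (1 - c)
  have hobs := hardyObs_tiltOf hc0 hc1
  have hstd0 := stdObs_zero c
  have hstd1 := stdObs_one c
  obtain ⟨t00, t01, t10, t11⟩ := stdState_apply c
  set a := √(1 - c)
  set b := √c
  set d := √(1 + c)
  set e := √(1 + 3 * c)
  have hE1 : a / e ≤ 1 := (div_le_one he0).2 hae
  have hE0 : 0 ≤ a / e := by positivity
  -- x and y are the cosine and sine of half the Bloch angle of the second observable: x²−y² = −a/e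
  -- and 2xy = 2b/e, so the rotation by them carries Z to that observable.
  obtain ⟨x, hx0, hx⟩ : ∃ x, 0 ≤ x ∧ x ^ 2 = (1 - a / e) / 2 :=
    ⟨√((1 - a / e) / 2), Real.sqrt_nonneg _, Real.sq_sqrt (by linarith)⟩
  obtain ⟨y, hy0, hy⟩ : ∃ y, 0 ≤ y ∧ y ^ 2 = (1 + a / e) / 2 :=
    ⟨√((1 + a / e) / 2), Real.sqrt_nonneg _, Real.sq_sqrt (by linarith)⟩
  have hxy : x * y = b / e := by
    refine (sq_eq_sq₀ (by positivity) (by positivity)).1 ?_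
    rw [mul_pow, hx, hy, div_pow, hb, he]
    have : (1 - a / e) / 2 * ((1 + a / e) / 2) = (e ^ 2 - a ^ 2) / (4 * e ^ 2) := by
      field_simp
      ring
    rw [this, ha, he]
    field_simp
    ring
  obtain ⟨E, hE⟩ : ∃ E, E = e⁻¹ := ⟨_, rfl⟩
  have hEe : E * e = 1 := by rw [hE, inv_mul_cancel₀ he0.ne']
  have hEe2 : E * (1 + 3 * c) = e := by rw [← he, sq, ← mul_assoc, hEe, one_mul]
  simp only [div_eq_mul_inv a e, div_eq_mul_inv b e, ← hE] at hx hy hxy hobs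
  have k1 : (x : ℂ) ^ 2 + y ^ 2 = 1 := by
    have : x ^ 2 + y ^ 2 = 1 := by rw [hx, hy]; ring
    exact_mod_cast this
  have k2 : (x : ℂ) ^ 2 - y ^ 2 = -(a * E) := by
    have : x ^ 2 - y ^ 2 = -(a * E) := by rw [hx, hy]; ring
    exact_mod_cast this
  have k3 : (x : ℂ) * y = b * E := by exact_mod_cast hxy
  have k4 : (a : ℂ) ^ 2 = 1 - c := by exact_mod_cast ha
  have k5 : (b : ℂ) ^ 2 = c := by exact_mod_cast hb
  have k6 : (E : ℂ) * (1 + 3 * c) = e := by exact_mod_cast hEe2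
  have hR : (!![(x : ℂ), -y; (y : ℂ), x])ᴴ * !![(x : ℂ), -y; (y : ℂ), x] = 1 := by
    ext i j
    fin_cases i <;> fin_cases j <;>
      simp [Matrix.mul_apply, Fin.sum_univ_two, Matrix.conjTranspose_apply] <;>
      first | ring1 | linear_combination k1
  have hO : ∀ z, hardyObs (hardyAngle (tiltOf c)) z =
      !![(x : ℂ), -y; (y : ℂ), x] * stdObs c z * (!![(x : ℂ), -y; (y : ℂ), x])ᴴ := by
    intro z
    rw [hobs]
    fin_cases z
    · simp only [Fin.zero_eta, hstd0]
      ext i j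
      fin_cases i <;> fin_cases j <;>
        simp [Matrix.mul_apply, Fin.sum_univ_two, Matrix.conjTranspose_apply, pauliX, pauliZ]
      · linear_combination -(1 - 2 * (c : ℂ)) * k2 + 4 * b * a * k3 + 4 * a * E * k5
      · linear_combination -2 * (1 - 2 * (c : ℂ)) * k3 - 2 * a * b * k2 + 2 * b * E * k4
      · linear_combination -2 * (1 - 2 * (c : ℂ)) * k3 - 2 * a * b * k2 + 2 * b * E * k4
      · linear_combination (1 - 2 * (c : ℂ)) * k2 - 4 * b * a * k3 - 4 * a * E * k5
    · simp only [Fin.mk_one, hstd1]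
      ext i j
      fin_cases i <;> fin_cases j <;>
        simp [Matrix.mul_apply, Fin.sum_univ_two, Matrix.conjTranspose_apply, pauliX, pauliZ]
      · linear_combination -k2
      · linear_combination -2 * k3
      · linear_combination -2 * k3
      · linear_combination k2
  refine ⟨!![(x : ℂ), -y; (y : ℂ), x], hR, hR, hO, hO, ?_⟩
  have hd' : (d : ℂ) ≠ 0 := by exact_mod_cast hd
  ext ⟨k, l⟩
  rw [kronecker_mulVec_apply]
  simp only [hardyState, hcos, hsin]
  fin_cases k <;> fin_cases l <;>
    simp [Fin.sum_univ_two, t00, t01, t10, t11] <;> field_simp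
  · linear_combination -4 * b * k3 - a * (k1 - k2) - k6 - 4 * E * k5 - E * k4
  · linear_combination b * k2 + a * k3
  · linear_combination b * k2 + a * k3
  · linear_combination 4 * b * k3 - a * (k1 + k2) + k6 + 4 * E * k5 + E * k4

end Parameters

/-! ### Reaching every partially entangled state. -/

section Schmidt

/-- A bipartite qubit vector as a matrix. -/
def amplitudeMatrix (φ : Fin 2 × Fin 2 → ℂ) : Matrix (Fin 2) (Fin 2) ℂ :=
  Matrix.of fun i j => φ (i, j)

theorem kronecker_mulVec_eq_mul (R R' : Matrix (Fin 2) (Fin 2) ℂ) (φ : Fin 2 × Fin 2 → ℂ)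
    (k l : Fin 2) : ((R ⊗ₖ R') *ᵥ φ) (k, l) = (R * amplitudeMatrix φ * R'ᵀ) k l := by
  rw [kronecker_mulVec_apply]
  simp only [Matrix.mul_apply, Fin.sum_univ_two, amplitudeMatrix, Matrix.of_apply,
    Matrix.transpose_apply]
  ring

/-- Matrices with the same singular values differ by unitaries. -/
theorem exists_unitary_mul_eq {Φ Ψ : Matrix (Fin 2) (Fin 2) ℂ} (hΨ : Ψ.det ≠ 0)
    (htr : (Φ * Φᴴ).trace = (Ψ * Ψᴴ).trace) (hdet : (Φ * Φᴴ).det = (Ψ * Ψᴴ).det) :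
    ∃ R R' : Matrix (Fin 2) (Fin 2) ℂ, Rᴴ * R = 1 ∧ R'ᴴ * R' = 1 ∧ Φ = R * Ψ * R'ᵀ := by
  have h₁ := Matrix.isHermitian_mul_conjTranspose_self Φ
  have h₂ := Matrix.isHermitian_mul_conjTranspose_self Ψ
  -- In dimension two, trace and determinant give the characteristic polynomial.
  have hev : h₁.eigenvalues = h₂.eigenvalues := by
    rw [Matrix.IsHermitian.eigenvalues_eq_eigenvalues_iff, Matrix.charpoly_fin_two,
      Matrix.charpoly_fin_two, htr, hdet]
  obtain ⟨U, hU, hU', hΦ⟩ := h₁.exists_diagonalization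
  obtain ⟨W, hW, hW', hΨΨ⟩ := h₂.exists_diagonalization
  rw [hev] at hΦ
  have hR : (U * Wᴴ)ᴴ * (U * Wᴴ) = 1 := by
    rw [Matrix.conjTranspose_mul, Matrix.conjTranspose_conjTranspose, mul_assoc, ← mul_assoc Uᴴ,
      hU', one_mul, hW]
  have hR2 : (U * Wᴴ) * (U * Wᴴ)ᴴ = 1 := mul_eq_one_comm.1 hR
  have hconj : (U * Wᴴ)ᴴ * (Φ * Φᴴ) * (U * Wᴴ) = Ψ * Ψᴴ := by
    rw [hΦ, Matrix.conjTranspose_mul, Matrix.conjTranspose_conjTranspose]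
    calc _ = W * (Uᴴ * U) * Matrix.diagonal (fun i => (h₂.eigenvalues i : ℂ)) * (Uᴴ * U) * Wᴴ := by
          simp only [mul_assoc]
      _ = Ψ * Ψᴴ := by rw [hU', mul_one, mul_one]; exact hΨΨ.symm
  generalize U * Wᴴ = R at *
  have hu : IsUnit Ψ.det := isUnit_iff_ne_zero.2 hΨ
  -- As Ψ is invertible, the right factor is forced; it is unitary because R conjugates ΦΦᴴ into
  -- ΨΨᴴ.
  have hQ : (Ψ⁻¹ * Rᴴ * Φ) * (Ψ⁻¹ * Rᴴ * Φ)ᴴ = 1 := by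
    rw [Matrix.conjTranspose_mul (Ψ⁻¹ * Rᴴ), Matrix.conjTranspose_mul,
      Matrix.conjTranspose_conjTranspose]
    calc _ = Ψ⁻¹ * (Rᴴ * (Φ * Φᴴ) * R) * (Ψ⁻¹)ᴴ := by simp only [mul_assoc]
      _ = (Ψ⁻¹ * Ψ) * (Ψ⁻¹ * Ψ)ᴴ := by
        rw [hconj, Matrix.conjTranspose_mul]
        simp only [mul_assoc]
      _ = 1 := by rw [Matrix.nonsing_inv_mul _ hu, Matrix.conjTranspose_one, mul_one]
  refine ⟨R, (Ψ⁻¹ * Rᴴ * Φ)ᵀ, hR, ?_, ?_⟩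
  · rw [show ∀ Q : Matrix (Fin 2) (Fin 2) ℂ, Qᵀᴴ = Qᴴᵀ from fun _ => rfl, ← Matrix.transpose_mul, hQ, Matrix.transpose_one]
  · rw [Matrix.transpose_transpose]
    calc Φ = R * Rᴴ * Φ := by rw [hR2, one_mul]
      _ = R * (Ψ * Ψ⁻¹) * Rᴴ * Φ := by rw [Matrix.mul_nonsing_inv _ hu, mul_one]
      _ = _ := by simp only [mul_assoc]

/-- A 2×2 amplitude matrix of determinant zero has rank at most one, that is, a product vector. -/
theorem det_ne_zero_of_isEntangled {φ : Fin 2 × Fin 2 → ℂ} (h : IsEntangled φ) :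
    (amplitudeMatrix φ).det ≠ 0 := by
  intro h0
  apply h
  simp only [Matrix.det_fin_two, amplitudeMatrix, Matrix.of_apply] at h0
  by_cases h00 : φ (0, 0) = 0
  · rw [h00, zero_mul, zero_sub, neg_eq_zero, mul_eq_zero] at h0
    rcases h0 with h1 | h1
    · refine ⟨![0, 1], fun j => φ (1, j), fun i j => ?_⟩
      fin_cases i <;> fin_cases j <;> simp [h00, h1]
    · refine ⟨fun i => φ (i, 1), ![0, 1], fun i j => ?_⟩
      fin_cases i <;> fin_cases j <;> simp [h00, h1]
  · refine ⟨![1, φ (1, 0) / φ (0, 0)], fun j => φ (0, j), fun i j => ?_⟩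
    fin_cases i <;> fin_cases j <;> simp
    · field_simp
    · field_simp
      linear_combination h0

/-- By Lagrange's identity |det|² + |g|² = uv, where u, v are the squared norms of the rows and g is
their inner product. As u + v = 1, |det| ≥ 1/2 forces u = v = 1/2 and g = 0, a maximally mixed
reduced state. -/
theorem norm_det_lt_half {φ : Fin 2 × Fin 2 → ℂ} (hφ : ∑ p, ‖φ p‖ ^ 2 = 1)
    (h : ¬ IsMaximallyEntangled φ) : ‖(amplitudeMatrix φ).det‖ < 1 / 2 := by
  by_contra! hge
  apply h
  simp only [Fintype.sum_prod_type, Fin.sum_univ_two, ← Complex.normSq_eq_norm_sq] at hφ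
  have hsq : 1 / 4 ≤ Complex.normSq (amplitudeMatrix φ).det := by
    rw [Complex.normSq_eq_norm_sq]
    nlinarith
  simp only [Matrix.det_fin_two, amplitudeMatrix, Matrix.of_apply] at hsq
  obtain ⟨g, hg⟩ : ∃ g, g = φ (0, 0) * star (φ (1, 0)) + φ (0, 1) * star (φ (1, 1)) := ⟨_, rfl⟩
  have lagrange : Complex.normSq (φ (0, 0) * φ (1, 1) - φ (0, 1) * φ (1, 0)) + Complex.normSq g =
      (Complex.normSq (φ (0, 0)) + Complex.normSq (φ (0, 1))) *
        (Complex.normSq (φ (1, 0)) + Complex.normSq (φ (1, 1))) := by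
    rw [hg]
    simp only [Complex.normSq_apply, Complex.sub_re, Complex.sub_im, Complex.add_re,
      Complex.add_im, Complex.mul_re, Complex.mul_im, RCLike.star_def, Complex.conj_re,
      Complex.conj_im]
    ring
  have hgn := Complex.normSq_nonneg g
  set u := Complex.normSq (φ (0, 0)) + Complex.normSq (φ (0, 1)) with hu
  set v := Complex.normSq (φ (1, 0)) + Complex.normSq (φ (1, 1)) with hv
  have huv : u + v = 1 := by linarith
  have hsq2 : (u - v) ^ 2 = 0 := by nlinarith [sq_nonneg (u - v)]
  have huv2 : u - v = 0 := by simpa using hsq2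
  have u2 : u = 1 / 2 := by linarith
  have v2 : v = 1 / 2 := by linarith
  have g0 : g = 0 := by
    rw [u2, v2] at lagrange
    exact Complex.normSq_eq_zero.1 (by linarith)
  have g1 : φ (1, 0) * star (φ (0, 0)) + φ (1, 1) * star (φ (0, 1)) = 0 := by
    have := congrArg star (hg.symm.trans g0)
    simpa [mul_comm] using this
  rw [IsMaximallyEntangled]
  ext i j
  fin_cases i <;> fin_cases j
  · have : (u : ℂ) = 1 / 2 := by rw [u2]; norm_num
    rw [hu] at this
    push_cast [← Complex.mul_conj] at this
    simpa [Fin.sum_univ_two] using this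
  · simpa [Fin.sum_univ_two] using hg.symm.trans g0
  · simpa [Fin.sum_univ_two] using g1
  · have : (v : ℂ) = 1 / 2 := by rw [v2]; norm_num
    rw [hv] at this
    push_cast [← Complex.mul_conj] at this
    simpa [Fin.sum_univ_two] using this

theorem trace_amplitudeMatrix (φ : Fin 2 × Fin 2 → ℂ) :
    (amplitudeMatrix φ * (amplitudeMatrix φ)ᴴ).trace = (nsq φ : ℂ) := by
  simp [Matrix.trace, Matrix.mul_apply, nsq, Fintype.sum_prod_type, Fin.sum_univ_two,
    amplitudeMatrix, Complex.mul_conj]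

theorem det_mul_conjTranspose (M : Matrix (Fin 2) (Fin 2) ℂ) :
    (M * Mᴴ).det = ((‖M.det‖ ^ 2 : ℝ) : ℂ) := by
  rw [Matrix.det_mul, Matrix.det_conjTranspose, RCLike.star_def, Complex.mul_conj,
    Complex.normSq_eq_norm_sq]

/-- For unit vectors |det| fixes both singular values, and it is c/(1+c) for `stdState c`. Solving
c/(1+c) = δ puts c in (0,1) exactly when 0 < δ < 1/2. -/
theorem exists_isStdModel {φ : Fin 2 × Fin 2 → ℂ} (hφ : ∑ p, ‖φ p‖ ^ 2 = 1)
    (he : IsEntangled φ) (hm : ¬ IsMaximallyEntangled φ) :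
    ∃ c, 0 < c ∧ c < 1 ∧ ∃ A B R R', IsStdModel c φ A B R R' := by
  have h0 : 0 < ‖(amplitudeMatrix φ).det‖ := norm_pos_iff.2 (det_ne_zero_of_isEntangled he)
  have h1 := norm_det_lt_half hφ hm
  obtain ⟨δ, hδ⟩ : ∃ δ, δ = ‖(amplitudeMatrix φ).det‖ := ⟨_, rfl⟩
  rw [← hδ] at h0 h1
  have hd : 0 < 1 - δ := by linarith
  obtain ⟨c, hc⟩ : ∃ c, c = δ / (1 - δ) := ⟨_, rfl⟩
  have hc0 : 0 < c := by rw [hc]; positivity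
  have hc1 : c < 1 := by rw [hc, div_lt_one hd]; linarith
  have hcδ : c / (1 + c) = δ := by rw [hc]; field_simp; ring
  have hdet : (amplitudeMatrix (stdState c)).det = -((c / (1 + c) : ℝ) : ℂ) := by
    obtain ⟨t00, t01, t10, t11⟩ := stdState_apply c
    simp only [Matrix.det_fin_two, amplitudeMatrix, Matrix.of_apply, t00, t01, t10]
    have : (c / (1 + c) : ℝ) = √c / √(1 + c) * (√c / √(1 + c)) := by
      rw [div_mul_div_comm, Real.mul_self_sqrt hc0.le, Real.mul_self_sqrt (by linarith)]
    rw [this]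
    push_cast
    ring
  rw [hcδ] at hdet
  have hn : nsq φ = 1 := by
    rw [← hφ]
    exact Finset.sum_congr rfl fun p _ => Complex.normSq_eq_norm_sq _
  obtain ⟨R, R', hR, hR', hΦ⟩ := exists_unitary_mul_eq (Φ := amplitudeMatrix φ)
    (Ψ := amplitudeMatrix (stdState c))
    (by rw [hdet, neg_ne_zero]; exact_mod_cast h0.ne')
    (by rw [trace_amplitudeMatrix, trace_amplitudeMatrix, hn, nsq_stdState hc0 hc1])
    (by
      rw [det_mul_conjTranspose, det_mul_conjTranspose, hdet, norm_neg, Complex.norm_real, ← hδ,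
        Real.norm_of_nonneg h0.le])
  refine ⟨c, hc0, hc1, _, _, R, R', hR, hR', fun _ => rfl, fun _ => rfl, ?_⟩
  ext ⟨k, l⟩
  rw [kronecker_mulVec_eq_mul, ← hΦ]
  rfl

end Schmidt

/-! ### The theorem. -/

theorem proposition1 :
    -- the classical bound, which is the maximum over all local hidden variable models
    (∀ w : ℝ,
      (∀ (Ω : Type*) [MeasurableSpace Ω] (m : LHVModel Ω),
        HardyZero m.behavior → hardyValue w m.behavior ≤ max 0 w) ∧
      (∃ m : LHVModel Unit, HardyZero m.behavior ∧ hardyValue w m.behavior = max 0 w)) ∧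
    (∀ w ∈ Set.Ioo (-1 / 4 : ℝ) 1,
      -- the quantum value exceeds the classical bound
      max 0 w < hardyQuantumValue w ∧
      -- it is attained by the explicit two-qubit strategy
      (∃ s : QuantumStrategy (Fin 2) (Fin 2),
        s.ρ = pureState (hardyState (hardyAngle w)) ∧
        s.A = hardyObs (hardyAngle w) ∧ s.B = hardyObs (hardyAngle w) ∧ s.Attains w) ∧
      (∀ (ιA ιB : Type*) [Fintype ιA] [DecidableEq ιA] [Fintype ιB] [DecidableEq ιB]
        (s : QuantumStrategy ιA ιB),
        -- it is the maximal quantum value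
        (HardyZero s.behavior → hardyValue w s.behavior ≤ hardyQuantumValue w) ∧
        -- up to local isometries it is attained by the explicit strategy only
        (s.Attains w ↔
          s.IsLocallyEquivalentTo (hardyState (hardyAngle w))
            (hardyObs (hardyAngle w)) (hardyObs (hardyAngle w))))) ∧
    -- every entangled two-qubit state that is not maximally entangled is self-tested
    (∀ φ : Fin 2 × Fin 2 → ℂ, ∑ p, ‖φ p‖ ^ 2 = 1 → IsEntangled φ → ¬ IsMaximallyEntangled φ →
      ∃ w ∈ Set.Ioo (-1 / 4 : ℝ) 1, ∃ s₀ : QuantumStrategy (Fin 2) (Fin 2),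
        s₀.ρ = pureState φ ∧ s₀.Attains w ∧
        ∀ (ιA ιB : Type*) [Fintype ιA] [DecidableEq ιA] [Fintype ιB] [DecidableEq ιB]
          (s : QuantumStrategy ιA ιB),
          s.Attains w ↔ s.IsLocallyEquivalentTo φ s₀.A s₀.B) := by

  refine ⟨fun w => ⟨fun Ω _ m hz => m.hardyValue_le w hz, exists_lhvModel_hardyValue_eq w⟩,
    fun w hw => ?_, fun φ hφ he hm => ?_⟩
  · obtain ⟨c, hc0, hc1, rfl⟩ := exists_tiltOf_eq hw
    obtain ⟨R, hm⟩ := exists_isStdModel_hardy hc0 hc1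
    simp only [QuantumStrategy.Attains, hardyQuantumValue_tiltOf hc0]
    exact ⟨max_lt_valueOf hc0 hc1,
      ⟨hm.strategy hc0 hc1, rfl, rfl, rfl, hm.strategy_hardy hc0 hc1⟩,
      fun _ _ _ _ _ _ s => ⟨s.hardyValue_le hc0 hc1, hm.selfTest hc0 hc1 s⟩⟩
  · obtain ⟨c, hc0, hc1, A, B, R, R', hs⟩ := exists_isStdModel hφ he hm
    refine ⟨tiltOf c, tiltOf_mem hc0 hc1, hs.strategy hc0 hc1, rfl, ?_, fun _ _ _ _ _ _ s => ?_⟩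
    · simpa only [QuantumStrategy.Attains, hardyQuantumValue_tiltOf hc0] using
        hs.strategy_hardy hc0 hc1
    · rw [QuantumStrategy.Attains, hardyQuantumValue_tiltOf hc0]
      exact hs.selfTest hc0 hc1 s
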